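/- Let $\log$ denote the binary logarithm, and for $k\in\mathbb N=\{0,1,2,\dots\}$ let $s_k := 4k\log k+4k\log\log k+16k$ if $k\ge 2$, and $s_k:=1$ if $k\le 1$. Then $s_k=\Theta(k\log k)$ as $k\to\infty$, and there is a function $f:\mathbb N^2\to\mathbb R_{\ge 0}$ with $$f(k,\ell)=(2\ell+4)(k-1)+\left(\tfrac{3\ell}{2}+1\right)s_k\qquad\text{for all } k\ge 1,\ \ell\ge 0,$$ so that $f(k,\ell)=O(\ell\cdot k\log k)$ (that is, there is an absolute constant $C$ with $f(k,\ell)\le C\,\ell\, k\log k$ for all $k\ge 2$, $\ell\ge 1$), such that for all $k,\ell\in\mathbb N$ and every (simple, finite or infinite) graph $G$, at least one of the following holds: - $G$ contains $k$ pairwise vertex-disjoint cycles, each of length at least $\ell$; - there is a set of at most $f(k,\ell)$ vertices of $G$ meeting every cycle of $G$ of length at least $\ell$. -/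

import Mathlib

/-- The sequence `s k = 4 k log k + 4 k log log k + 16 k` for `k ≥ 2` (binary logarithms),
and `s k = 1` for `k ≤ 1`. -/
noncomputable def sSeq (k : ℕ) : ℝ :=
  if 2 ≤ k then
    4 * (k : ℝ) * Real.logb 2 k + 4 * (k : ℝ) * Real.logb 2 (Real.logb 2 k) + 16 * (k : ℝ)
  else 1

/-- `G` contains `k` pairwise vertex-disjoint cycles, each of length at least `ℓ`. -/
def HasDisjointLongCycles {V : Type*} (G : SimpleGraph V) (k ℓ : ℕ) : Prop :=
  ∃ (v : Fin k → V) (c : ∀ i : Fin k, G.Walk (v i) (v i)),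
    (∀ i, (c i).IsCycle ∧ ℓ ≤ (c i).length) ∧
    ∀ i j, i ≠ j → ∀ x, x ∈ (c i).support → x ∉ (c j).support

/-- The vertex set `X` meets every cycle of `G` of length at least `ℓ`. -/
def MeetsLongCycles {V : Type*} (G : SimpleGraph V) (ℓ : ℕ) (X : Finset V) : Prop :=
  ∀ (v : V) (c : G.Walk v v), c.IsCycle → ℓ ≤ c.length → ∃ x ∈ X, x ∈ c.support

namespace CyclePacking

open scoped Classical

variable {V : Type*}

/-! Suppose `G` has no `k` disjoint long cycles. Take a subgraph `K` of `G` on a finite vertex set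
`S`, with all degrees two or three and all cycles of length at least `ℓ`. Any `k` disjoint cycles of
`K` would be long cycles of `G`, so a Simonovits-type packing lemma (`hasCarriers_of_sSeq_le`)
bounds the set `U` of cubic vertices by `|U| < sSeq k`. That lemma repeatedly takes out a cycle with
only logarithmically many branch vertices, found by suppressing vertices of degree two and applying
the Moore bound to the resulting cubic graph. "Carriers", vertex sets inducing minimum degree two,
stand in for cycles throughout and become cycles only at the end.

Choose `K` to maximise `|U|` and then the number of disjoint carriers off `U` (`exists_extremal`).
Maximality has two consequences: every long cycle of `G` meets `S`, and the ends of a path of `G`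
that has only its ends in `S`, these being nonadjacent in `K` and outside `U`, are at distance less
than `ℓ` in `K`.

Let `B` be the ball in `K` of radius about `ℓ / 2` around `U`. A short path of `K` between vertices
outside `B` avoids `U`, hence runs in `S \ U`, a disjoint union of paths and cycles. Cut open each
cyclic component by a set of `ℓ + 2` vertices and lay everything out on a line
(`exists_arrangement`). The positions visited by a long cycle avoiding `B` and the cuts then have no
gap of length `ℓ + 2`. A greedy argument on the line (`exists_separated_and_hitting`) gives either
`k` traces far apart, whose cycles must be disjoint, or at most `k - 1` windows of length `ℓ + 2`
meeting all traces. The ball, the cuts and the windows form the hitting set. -/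

/-- The number of neighbours of `v` in the finite set `S`. -/
noncomputable def degIn (K : SimpleGraph V) (S : Finset V) (v : V) : ℕ :=
  (S.filter (K.Adj v)).card

/-- The vertices of `S` having exactly three neighbours in `S`. -/
noncomputable def branch (K : SimpleGraph V) (S : Finset V) : Finset V :=
  S.filter (fun v => degIn K S v = 3)

/-- The sum of the degrees of the subgraph induced by `S`. -/
noncomputable def degSum (K : SimpleGraph V) (S : Finset V) : ℕ :=
  ∑ v ∈ S, degIn K S v

/-- A nonempty finite vertex set inducing a subgraph of minimum degree at least two. -/
def IsCarrier (K : SimpleGraph V) (C : Finset V) : Prop :=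
  C.Nonempty ∧ ∀ v ∈ C, 2 ≤ degIn K C v

/-! ### Degree sums and pruning to minimum degree two -/

lemma degIn_eq_sum (K : SimpleGraph V) (S : Finset V) (v : V) :
    degIn K S v = ∑ w ∈ S, if K.Adj v w then 1 else 0 := by
  rw [degIn, Finset.card_filter]

lemma degIn_eq_card (K : SimpleGraph V) (S : Finset V) (v : V) [DecidablePred (K.Adj v)] :
    degIn K S v = (S.filter (K.Adj v)).card := by
  unfold degIn
  congr

lemma degIn_mono (K : SimpleGraph V) {S T : Finset V} (h : S ⊆ T) (v : V) :
    degIn K S v ≤ degIn K T v :=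
  Finset.card_le_card (Finset.filter_subset_filter _ h)

lemma degIn_mono_graph {K L : SimpleGraph V} (h : K ≤ L) (S : Finset V) (v : V) :
    degIn K S v ≤ degIn L S v :=
  Finset.card_le_card fun x hx => by
    simp only [Finset.mem_filter] at hx ⊢
    exact ⟨hx.1, h hx.2⟩

lemma degIn_union (K : SimpleGraph V) {S T : Finset V} (h : Disjoint S T) (v : V) :
    degIn K (S ∪ T) v = degIn K S v + degIn K T v := by
  simp only [degIn_eq_sum, Finset.sum_union h]

lemma degIn_insert (K : SimpleGraph V) {S : Finset V} {x : V} (h : x ∉ S) (v : V) :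
    degIn K (insert x S) v = degIn K S v + if K.Adj v x then 1 else 0 := by
  simp only [degIn_eq_sum, Finset.sum_insert h]
  omega

lemma degIn_insert_self (K : SimpleGraph V) (S : Finset V) (x : V) :
    degIn K (insert x S) x = degIn K S x := by
  unfold degIn
  rw [Finset.filter_insert, if_neg (K.loopless.irrefl x)]

lemma sum_degIn_comm (K : SimpleGraph V) (S T : Finset V) :
    ∑ v ∈ S, degIn K T v = ∑ v ∈ T, degIn K S v := by
  simp only [degIn_eq_sum]
  rw [Finset.sum_comm]
  simp only [K.adj_comm]

lemma degSum_union (K : SimpleGraph V) {S T : Finset V} (h : Disjoint S T) :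
    degSum K (S ∪ T) = degSum K S + degSum K T + 2 * ∑ v ∈ T, degIn K S v := by
  unfold degSum
  rw [Finset.sum_union h]
  simp only [degIn_union K h, Finset.sum_add_distrib]
  rw [sum_degIn_comm K S T]
  ring

lemma degSum_insert (K : SimpleGraph V) {S : Finset V} {x : V} (h : x ∉ S) :
    degSum K (insert x S) = degSum K S + 2 * degIn K S x := by
  have := degSum_union K (S := S) (T := {x}) (by simpa using h)
  rw [Finset.union_comm, ← Finset.insert_eq] at this
  rw [this]
  simp [degSum, degIn, Finset.filter_singleton]

lemma degSum_erase (K : SimpleGraph V) {S : Finset V} {x : V} (h : x ∈ S) :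
    degSum K S = degSum K (S.erase x) + 2 * degIn K S x := by
  have h1 := degSum_insert K (Finset.notMem_erase x S)
  have h2 := degIn_insert_self K (S.erase x) x
  rw [Finset.insert_erase h] at h1 h2
  rw [h1, h2]

/-- Deleting a vertex of degree at most one lowers the degree sum by at most two, so average degree
at least two survives. The deletions stop before the set is empty because a single vertex has degree
sum zero. -/
lemma exists_isCarrier_of_two_mul_card_le (K : SimpleGraph V) (Q : Finset V) (hQ : Q.Nonempty)
    (h : 2 * Q.card ≤ degSum K Q) : ∃ C ⊆ Q, IsCarrier K C := by
  induction hn : Q.card generalizing Q with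
  | zero => simp [Finset.card_eq_zero] at hn; simp [hn] at hQ
  | succ n ih =>
    by_cases hall : ∀ v ∈ Q, 2 ≤ degIn K Q v
    · exact ⟨Q, subset_rfl, hQ, hall⟩
    push Not at hall
    obtain ⟨x, hx, hd⟩ := hall
    have h1 := degSum_erase K hx
    have h2 := Finset.card_erase_of_mem hx
    have hne : (Q.erase x).Nonempty := by
      rw [Finset.nonempty_iff_ne_empty]
      intro he
      have h3 := degIn_insert_self K (Q.erase x) x
      rw [Finset.insert_erase hx, he] at h3
      rw [he] at h1
      have h4 : degSum K ∅ = 0 := rfl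
      have h5 : degIn K ∅ x = 0 := rfl
      omega
    obtain ⟨C, hC, hC'⟩ := ih (Q.erase x) hne (by omega) (by omega)
    exact ⟨C, hC.trans (Finset.erase_subset _ _), hC'⟩

/-- Deleting vertices of degree at most one never decreases the degree sum minus twice the size.
Here the process may end with the empty set. -/
lemma exists_subset_two_le_degIn (K : SimpleGraph V) (Q : Finset V) :
    ∃ S ⊆ Q, (∀ v ∈ S, 2 ≤ degIn K S v) ∧
      degSum K Q + 2 * S.card ≤ degSum K S + 2 * Q.card := by
  induction hn : Q.card generalizing Q with
  | zero =>
    refine ⟨Q, subset_rfl, ?_, by omega⟩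
    simp [Finset.card_eq_zero] at hn
    simp [hn]
  | succ n ih =>
    by_cases hall : ∀ v ∈ Q, 2 ≤ degIn K Q v
    · exact ⟨Q, subset_rfl, hall, by omega⟩
    push Not at hall
    obtain ⟨x, hx, hd⟩ := hall
    have h1 := degSum_erase K hx
    have h2 := Finset.card_erase_of_mem hx
    obtain ⟨S, hS, hS', hle⟩ := ih (Q.erase x) (by omega)
    exact ⟨S, hS.trans (Finset.erase_subset _ _), hS', by omega⟩

lemma sum_degIn_eq (K : SimpleGraph V) {S C : Finset V} (hCS : C ⊆ S)
    (h : ∀ v ∈ S, degIn K S v = 2 ∨ degIn K S v = 3) :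
    ∑ v ∈ C, degIn K S v = 2 * C.card + (C ∩ branch K S).card := by
  have h1 : C ∩ branch K S = C.filter (fun v => degIn K S v = 3) := by
    ext v
    simp only [branch, Finset.mem_inter, Finset.mem_filter]
    exact ⟨fun h => ⟨h.1, h.2.2⟩, fun h => ⟨h.1, hCS h.1, h.2⟩⟩
  rw [h1, Finset.card_filter, mul_comm, ← smul_eq_mul, ← Finset.sum_const, ← Finset.sum_add_distrib]
  refine Finset.sum_congr rfl fun v hv => ?_
  rcases h v (hCS hv) with h | h <;> simp [h]

lemma branch_subset (K : SimpleGraph V) (S : Finset V) : branch K S ⊆ S :=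
  Finset.filter_subset _ _

/-- Removing a carrier with few branch vertices and pruning loses few branch vertices. -/
lemma exists_prune (K : SimpleGraph V) {S C : Finset V} (hCS : C ⊆ S)
    (h : ∀ v ∈ S, degIn K S v = 2 ∨ degIn K S v = 3) (hC : IsCarrier K C) :
    ∃ S' ⊆ S, Disjoint S' C ∧ (∀ v ∈ S', degIn K S' v = 2 ∨ degIn K S' v = 3) ∧
      (branch K S).card ≤ (branch K S').card + 2 * (C ∩ branch K S).card := by
  obtain ⟨S', hS', hdeg, hle⟩ := exists_subset_two_le_degIn K (S \ C)
  have hS'S : S' ⊆ S := hS'.trans Finset.sdiff_subset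
  have hdeg' : ∀ v ∈ S', degIn K S' v = 2 ∨ degIn K S' v = 3 := by
    intro v hv
    have h1 := hdeg v hv
    have h2 := degIn_mono K hS'S v
    have h3 := h v (hS'S hv)
    omega
  refine ⟨S', hS'S, Finset.disjoint_of_subset_left hS' Finset.sdiff_disjoint, hdeg', ?_⟩
  -- When all degrees are two or three, the number of branch vertices is the degree sum minus twice
  -- the size, a quantity that pruning does not decrease. Since `C` has internal degrees at least
  -- two, at most `|C ∩ branch K S|` edges leave it, and removing `C` costs that number of edges
  -- plus `|C ∩ branch K S|`.
  have e1 := sum_degIn_eq K subset_rfl h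
  have e2 := sum_degIn_eq K subset_rfl hdeg'
  have e3 := sum_degIn_eq K hCS h
  rw [Finset.inter_eq_right.2 (branch_subset _ _)] at e1 e2
  have e4 := degSum_union K (S := S \ C) (T := C) Finset.sdiff_disjoint
  rw [Finset.sdiff_union_of_subset hCS] at e4
  have e5 : ∀ v, degIn K S v = degIn K (S \ C) v + degIn K C v := fun v => by
    rw [← degIn_union K Finset.sdiff_disjoint, Finset.sdiff_union_of_subset hCS]
  have e6 : ∑ v ∈ C, degIn K S v = ∑ v ∈ C, degIn K (S \ C) v + degSum K C := by
    simp only [e5, Finset.sum_add_distrib, degSum]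
  have e7 : 2 * C.card ≤ degSum K C := by
    have := Finset.sum_le_sum hC.2
    simpa [degSum, mul_comm] using this
  have e8 := Finset.card_sdiff_add_card_eq_card hCS
  unfold degSum at *
  omega

/-! ### Balls and the Moore bound -/

/-- The vertices at distance at most `i` from `A` in the subgraph induced by `S`. -/
noncomputable def ball (K : SimpleGraph V) (S A : Finset V) : ℕ → Finset V
  | 0 => A
  | i + 1 => ball K S A i ∪ S.filter (fun w => ∃ x ∈ ball K S A i, K.Adj x w)

lemma ball_subset_succ (K : SimpleGraph V) (S A : Finset V) (i : ℕ) :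
    ball K S A i ⊆ ball K S A (i + 1) :=
  Finset.subset_union_left

lemma ball_mono (K : SimpleGraph V) (S A : Finset V) : Monotone (ball K S A) :=
  monotone_nat_of_le_succ (ball_subset_succ K S A)

lemma ball_subset (K : SimpleGraph V) {S A : Finset V} (h : A ⊆ S) (i : ℕ) :
    ball K S A i ⊆ S := by
  induction i with
  | zero => exact h
  | succ i ih => exact Finset.union_subset ih (Finset.filter_subset _ _)

lemma mem_ball_succ_of_adj (K : SimpleGraph V) {S A : Finset V} {i : ℕ} {x w : V}
    (hx : x ∈ ball K S A i) (hw : w ∈ S) (h : K.Adj x w) : w ∈ ball K S A (i + 1) :=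
  Finset.mem_union_right _ (Finset.mem_filter.2 ⟨hw, x, hx, h⟩)

/-- The vertices at distance exactly `i` from `A`. -/
noncomputable def sphere (K : SimpleGraph V) (S A : Finset V) : ℕ → Finset V
  | 0 => A
  | i + 1 => ball K S A (i + 1) \ ball K S A i

lemma sphere_subset_ball (K : SimpleGraph V) (S A : Finset V) (i : ℕ) :
    sphere K S A i ⊆ ball K S A i := by
  cases i with
  | zero => exact subset_rfl
  | succ i => exact Finset.sdiff_subset

lemma exists_parent (K : SimpleGraph V) {S A : Finset V} {i : ℕ} {w : V}
    (hw : w ∈ sphere K S A (i + 1)) : ∃ x ∈ sphere K S A i, K.Adj w x := by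
  simp only [sphere, ball, Finset.mem_sdiff, Finset.mem_union, Finset.mem_filter] at hw
  obtain ⟨h | ⟨hS, x, hx, hxw⟩, hn⟩ := hw
  · exact absurd h hn
  refine ⟨x, ?_, hxw.symm⟩
  cases i with
  | zero => exact hx
  | succ i =>
    refine Finset.mem_sdiff.2 ⟨hx, fun hx' => hn ?_⟩
    exact mem_ball_succ_of_adj K hx' hS hxw

lemma sphere_disjoint_ball (K : SimpleGraph V) (S A : Finset V) {i j : ℕ} (h : i < j) {v : V}
    (hv : v ∈ sphere K S A j) : v ∉ ball K S A i := by
  cases j with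
  | zero => omega
  | succ j =>
    exact fun h' => (Finset.mem_sdiff.1 hv).2 (ball_mono K S A (Nat.lt_succ_iff.1 h) h')

/-- A neighbour of a vertex of a sphere lies in the same sphere or in an adjacent one. -/
lemma mem_sphere_of_adj (K : SimpleGraph V) {S A : Finset V} (hA : A ⊆ S) {i : ℕ} {x w : V}
    (hx : x ∈ sphere K S A (i + 1)) (hw : w ∈ S) (h : K.Adj x w) :
    w ∈ sphere K S A i ∨ w ∈ sphere K S A (i + 1) ∨ w ∈ sphere K S A (i + 2) := by
  have hxS := ball_subset K hA _ (sphere_subset_ball _ _ _ _ hx)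
  have h1 := mem_ball_succ_of_adj K (sphere_subset_ball _ _ _ _ hx) hw h
  by_cases h2 : w ∈ ball K S A (i + 1)
  · by_cases h3 : w ∈ ball K S A i
    · left
      cases i with
      | zero => exact h3
      | succ i =>
        refine Finset.mem_sdiff.2 ⟨h3, fun h4 => ?_⟩
        exact sphere_disjoint_ball K S A (Nat.lt_succ_self _) hx
          (mem_ball_succ_of_adj K h4 hxS h.symm)
    · exact Or.inr (Or.inl (Finset.mem_sdiff.2 ⟨h2, h3⟩))
  · exact Or.inr (Or.inr (Finset.mem_sdiff.2 ⟨h1, h2⟩))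

lemma one_le_degIn (K : SimpleGraph V) {Q : Finset V} {x y : V} (hy : y ∈ Q) (h : K.Adj x y) :
    1 ≤ degIn K Q x :=
  Finset.card_pos.2 ⟨y, Finset.mem_filter.2 ⟨hy, h⟩⟩

lemma two_le_degIn (K : SimpleGraph V) {Q : Finset V} {x y z : V} (hy : y ∈ Q) (hz : z ∈ Q)
    (hyz : y ≠ z) (h : K.Adj x y) (h' : K.Adj x z) : 2 ≤ degIn K Q x :=
  Finset.one_lt_card.2 ⟨y, Finset.mem_filter.2 ⟨hy, h⟩, z, Finset.mem_filter.2 ⟨hz, h'⟩, hyz⟩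

/-- The union of two descending paths in a breadth-first search tree. -/
lemma exists_ancestors (K : SimpleGraph V) {S : Finset V} {u : V} (i : ℕ) :
    ∀ x ∈ sphere K S {u} i, ∀ y ∈ sphere K S {u} i, x ≠ y →
      ∃ Q ⊆ ball K S {u} i, x ∈ Q ∧ y ∈ Q ∧ Q.card ≤ 2 * i + 1 ∧
        2 * Q.card ≤ degSum K Q + 2 ∧ (K.Adj x y → 2 * Q.card ≤ degSum K Q) := by
  induction i with
  | zero =>
    intro x hx y hy hne
    simp [sphere] at hx hy
    exact absurd (hx.trans hy.symm) hne
  | succ i ih =>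
    intro x hx y hy hne
    obtain ⟨x', hx', hxx'⟩ := exists_parent K hx
    obtain ⟨y', hy', hyy'⟩ := exists_parent K hy
    have hxb := sphere_disjoint_ball K S {u} (Nat.lt_succ_self i) hx
    have hyb := sphere_disjoint_ball K S {u} (Nat.lt_succ_self i) hy
    -- The bound `2 * Q.card ≤ degSum K Q + 2` says that `Q` spans at least `|Q| - 1` edges, as a
    -- tree does. Hanging `x` and `y` on their parents preserves this, and an edge `xy` supplies the
    -- missing one.
    suffices h : ∃ Q ⊆ ball K S {u} i, x' ∈ Q ∧ y' ∈ Q ∧ Q.card ≤ 2 * i + 1 ∧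
        2 * Q.card ≤ degSum K Q + 2 by
      obtain ⟨Q, hQ, hxQ, hyQ, hc, hd⟩ := h
      have hx0 : x ∉ Q := fun h => hxb (hQ h)
      have hy0 : y ∉ insert x Q := by
        simp only [Finset.mem_insert, not_or]
        exact ⟨hne.symm, fun h => hyb (hQ h)⟩
      have e1 := degSum_insert K hx0
      have e2 := degSum_insert K hy0
      have e3 := one_le_degIn K hxQ hxx'
      have e4 := one_le_degIn K (Finset.mem_insert_of_mem hyQ : y' ∈ insert x Q) hyy'
      have c1 := Finset.card_insert_of_notMem hx0
      have c2 := Finset.card_insert_of_notMem hy0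
      refine ⟨insert y (insert x Q), ?_, by simp, by simp, by omega, by omega, fun hxy => ?_⟩
      · refine Finset.insert_subset (sphere_subset_ball _ _ _ _ hy) (Finset.insert_subset
          (sphere_subset_ball _ _ _ _ hx) (hQ.trans (ball_subset_succ _ _ _ _)))
      · have hxy' : y' ≠ x := by
          rintro rfl
          exact hx0 hyQ
        have e5 := two_le_degIn K (Finset.mem_insert_of_mem hyQ : y' ∈ insert x Q)
          (Finset.mem_insert_self x Q) hxy' hyy' hxy.symm
        omega
    by_cases hxy : x' = y'
    · subst hxy
      exact ⟨{x'}, by simpa using sphere_subset_ball _ _ _ _ hx', by simp, by simp, by simp,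
        by simp⟩
    · obtain ⟨Q, h1, h2, h3, h4, h5, -⟩ := ih x' hx' y' hy' hxy
      exact ⟨Q, h1, h2, h3, h4, h5⟩

/-- An edge inside a sphere, or a vertex with two parents, would close two descending paths into a
set of at most `2j + 3` vertices with as many edges as vertices, and this contains a small carrier.
So each vertex beyond the root has two children, no child is shared, and the spheres double in size.
-/
lemma card_sphere_of_no_small_carrier (K : SimpleGraph V) {S : Finset V} {u : V} (hu : u ∈ S)
    (h3 : ∀ v ∈ S, degIn K S v = 3) (j : ℕ)
    (hno : ∀ C ⊆ S, IsCarrier K C → 2 * j + 3 < C.card) (i : ℕ) (hi : i ≤ j) :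
    3 * 2 ^ i ≤ (sphere K S {u} (i + 1)).card := by
  have huS : ({u} : Finset V) ⊆ S := by simpa using hu
  have hno' : ∀ Q ⊆ S, Q.Nonempty → Q.card ≤ 2 * j + 3 → degSum K Q < 2 * Q.card := by
    intro Q hQ hne hc
    by_contra hcon
    obtain ⟨C, hC, hC'⟩ := exists_isCarrier_of_two_mul_card_le K Q hne (by omega)
    have := hno C (hC.trans hQ) hC'
    have := Finset.card_le_card hC
    omega
  have hsame : ∀ m ≤ j + 1, ∀ x ∈ sphere K S {u} m, ∀ y ∈ sphere K S {u} m, ¬ K.Adj x y := by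
    intro m hm x hx y hy hxy
    obtain ⟨Q, hQ, hxQ, -, hc, -, hd⟩ := exists_ancestors K (S := S) m x hx y hy hxy.ne
    have := hno' Q (hQ.trans (ball_subset K huS m)) ⟨x, hxQ⟩ (by omega)
    have := hd hxy
    omega
  have hpar : ∀ m ≤ j, ∀ w ∈ sphere K S {u} (m + 1), ∀ x ∈ sphere K S {u} m,
      ∀ y ∈ sphere K S {u} m, K.Adj w x → K.Adj w y → x = y := by
    intro m hm w hw x hx y hy hwx hwy
    by_contra hne
    obtain ⟨Q, hQ, hxQ, hyQ, hc, hd, -⟩ := exists_ancestors K (S := S) m x hx y hy hne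
    have hwQ : w ∉ Q := fun h => sphere_disjoint_ball K S {u} (Nat.lt_succ_self m) hw (hQ h)
    have hsub : insert w Q ⊆ S := Finset.insert_subset
      (ball_subset K huS _ (sphere_subset_ball _ _ _ _ hw)) (hQ.trans (ball_subset K huS m))
    have e1 := degSum_insert K hwQ
    have e2 := two_le_degIn K hxQ hyQ hne hwx hwy
    have c1 := Finset.card_insert_of_notMem hwQ
    have := hno' _ hsub ⟨w, by simp⟩ (by omega)
    omega
  induction i with
  | zero =>
    have := h3 u hu
    rw [pow_zero, mul_one, ← this]
    refine Finset.card_le_card fun w hw => ?_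
    simp only [Finset.mem_filter] at hw
    refine Finset.mem_sdiff.2 ⟨mem_ball_succ_of_adj K (by simp [ball]) hw.1 hw.2, ?_⟩
    simpa [ball] using hw.2.ne'
  | succ i ih =>
    have ih := ih (by omega)
    have key := Finset.card_mul_le_card_mul (s := sphere K S {u} (i + 1))
      (t := sphere K S {u} (i + 2)) K.Adj (m := 2) (n := 1) ?_ ?_
    · rw [pow_succ, show i + 1 + 1 = i + 2 from rfl]; omega
    · intro x hx
      have hxS := ball_subset K huS _ (sphere_subset_ball _ _ _ _ hx)
      have e : S.filter (K.Adj x) ⊆ (sphere K S {u} i).filter (K.Adj x) ∪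
          (sphere K S {u} (i + 2)).bipartiteAbove K.Adj x := by
        intro w hw
        simp only [Finset.mem_filter] at hw
        simp only [Finset.mem_union, Finset.mem_filter, Finset.mem_bipartiteAbove]
        rcases mem_sphere_of_adj K huS hx hw.1 hw.2 with h | h | h
        · exact Or.inl ⟨h, hw.2⟩
        · exact absurd hw.2 (hsame _ (by omega) x hx w h)
        · exact Or.inr ⟨h, hw.2⟩
      have e1 := (Finset.card_le_card e).trans (Finset.card_union_le _ _)
      have e2 : ((sphere K S {u} i).filter (K.Adj x)).card ≤ 1 := by
        rw [Finset.card_le_one]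
        intro a ha b hb
        simp only [Finset.mem_filter] at ha hb
        exact hpar i (by omega) x hx a ha.1 b hb.1 ha.2 hb.2
      have e3 := h3 x hxS
      unfold degIn at e3
      omega
    · intro w hw
      rw [Finset.card_le_one]
      intro a ha b hb
      simp only [Finset.mem_bipartiteBelow] at ha hb
      exact hpar (i + 1) (by omega) w hw a ha.1 b hb.1 ha.2.symm hb.2.symm

/-- In a nonempty cubic graph on `n` vertices there is a carrier of size at most
`2 log₂ n + 2`. -/
lemma exists_small_carrier_of_cubic (K : SimpleGraph V) {S : Finset V} (hS : S.Nonempty)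
    (h3 : ∀ v ∈ S, degIn K S v = 3) :
    ∃ C ⊆ S, IsCarrier K C ∧ (C.card : ℝ) ≤ 2 * Real.logb 2 S.card + 2 := by
  obtain ⟨u, hu⟩ := hS
  have hcard : 2 ≤ S.card := by
    have h1 := h3 u hu
    have h2 : degIn K S u ≤ S.card := Finset.card_le_card (Finset.filter_subset _ _)
    omega
  -- For the least such `j`, the absence of a carrier of size at most `2j + 3` would give `9 * 4 ^ j
  -- ≤ n ^ 2 < 8 * 4 ^ j`, while minimality gives `2j + 1 ≤ 2 * log₂ n`.
  have hex : ∃ j, S.card ^ 2 < 2 ^ (2 * j + 3) := by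
    refine ⟨S.card, ?_⟩
    calc S.card ^ 2 < (2 ^ S.card) ^ 2 := Nat.pow_lt_pow_left Nat.lt_two_pow_self (by norm_num)
      _ = 2 ^ (2 * S.card) := by rw [← pow_mul, mul_comm]
      _ ≤ 2 ^ (2 * S.card + 3) := Nat.pow_le_pow_right (by norm_num) (by omega)
  obtain ⟨j, hj, hmin⟩ : ∃ j, S.card ^ 2 < 2 ^ (2 * j + 3) ∧ 2 ^ (2 * j + 1) ≤ S.card ^ 2 := by
    refine ⟨Nat.find hex, Nat.find_spec hex, ?_⟩
    rcases Nat.eq_zero_or_pos (Nat.find hex) with h | h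
    · rw [h, mul_zero, zero_add, pow_one]; nlinarith
    · have := Nat.find_min hex (Nat.sub_lt h one_pos)
      have e : 2 * (Nat.find hex - 1) + 3 = 2 * Nat.find hex + 1 := by omega
      rw [e] at this
      omega
  by_cases hno : ∀ C ⊆ S, IsCarrier K C → 2 * j + 3 < C.card
  · exfalso
    have h1 := card_sphere_of_no_small_carrier K hu h3 j hno j le_rfl
    have h2 := Finset.card_le_card ((sphere_subset_ball K S {u} (j + 1)).trans
      (ball_subset K (by simpa using hu) _))
    have h3 : (3 * 2 ^ j) ^ 2 ≤ S.card ^ 2 := Nat.pow_le_pow_left (h1.trans h2) 2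
    have h4 : 2 ^ (2 * j + 3) = 8 * (2 ^ j) ^ 2 := by rw [pow_add, pow_mul']; ring
    nlinarith [pow_pos (two_pos : (0 : ℕ) < 2) j]
  · push Not at hno
    obtain ⟨C, hC, hC', hc⟩ := hno
    refine ⟨C, hC, hC', ?_⟩
    have h1 : (2 * j + 1 : ℝ) ≤ 2 * Real.logb 2 S.card := by
      have hpos : (0 : ℝ) < S.card := by positivity
      have : ((2 * j + 1 : ℕ) : ℝ) ≤ Real.logb 2 ((S.card : ℝ) ^ 2) := by
        rw [Real.le_logb_iff_rpow_le (by norm_num) (by positivity), Real.rpow_natCast]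
        exact_mod_cast hmin
      rw [Real.logb_pow] at this
      push_cast at this
      linarith
    have h2 : (C.card : ℝ) ≤ 2 * j + 3 := by exact_mod_cast hc
    linarith

/-! ### Suppressing vertices of degree two -/

/-- Replacing the path `a v b` by an edge `ab` lets `a` and `b` exchange the neighbour `v` for each
other; nonadjacency makes the edge genuinely new. -/
lemma degIn_sup_edge (K : SimpleGraph V) {S T : Finset V} {v a b : V} (hab : a ≠ b)
    (hN : S.filter (K.Adj v) = {a, b}) (hadj : ¬ K.Adj a b) (hT : T ⊆ S) (hv : v ∉ T)
    (ha : a ∈ T) (hb : b ∈ T) {w : V} (hw : w ∈ T) :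
    degIn (K ⊔ SimpleGraph.edge a b) T w = degIn K (insert v T) w := by
  have hN' : ∀ x ∈ S, K.Adj v x ↔ x = a ∨ x = b := fun x hx => by
    have : x ∈ S.filter (K.Adj v) ↔ x ∈ ({a, b} : Finset V) := by rw [hN]
    simpa [hx] using this
  rw [degIn_insert K hv, K.adj_comm w v]
  simp only [hN' w (hT hw)]
  by_cases hwa : w = a
  · subst hwa
    have : T.filter ((K ⊔ SimpleGraph.edge w b).Adj w) = insert b (T.filter (K.Adj w)) := by
      ext x
      simp only [Finset.mem_filter, SimpleGraph.sup_adj, SimpleGraph.edge_adj, Finset.mem_insert]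
      grind
    rw [degIn_eq_card, this, Finset.card_insert_of_notMem (by simp [hadj])]
    simp [← degIn_eq_card]
  by_cases hwb : w = b
  · subst hwb
    have : T.filter ((K ⊔ SimpleGraph.edge a w).Adj w) = insert a (T.filter (K.Adj w)) := by
      ext x
      simp only [Finset.mem_filter, SimpleGraph.sup_adj, SimpleGraph.edge_adj, Finset.mem_insert]
      grind
    rw [degIn_eq_card, this, Finset.card_insert_of_notMem (by simp [K.adj_comm w a, hadj])]
    simp [← degIn_eq_card]
  · have : T.filter ((K ⊔ SimpleGraph.edge a b).Adj w) = T.filter (K.Adj w) := by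
      ext x
      simp only [Finset.mem_filter, SimpleGraph.sup_adj, SimpleGraph.edge_adj]
      grind
    rw [degIn_eq_card, this]
    simp [← degIn_eq_card, hwa, hwb]

/-- A graph with all degrees two or three has a carrier with few branch vertices. -/
lemma exists_carrier_few_branch (K : SimpleGraph V) (S : Finset V)
    (h : ∀ v ∈ S, degIn K S v = 2 ∨ degIn K S v = 3) (hU : (branch K S).Nonempty) :
    ∃ C ⊆ S, IsCarrier K C ∧
      ((C ∩ branch K S).card : ℝ) ≤ 2 * Real.logb 2 (branch K S).card + 2 := by
  induction hn : S.card generalizing K S with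
  | zero =>
    rw [Finset.card_eq_zero] at hn
    subst hn
    simp [branch] at hU
  | succ n ih =>
    by_cases h3 : ∀ v ∈ S, degIn K S v = 3
    · have hb : branch K S = S := Finset.filter_true_of_mem h3
      obtain ⟨C, hC, hC', hc⟩ := exists_small_carrier_of_cubic K (hb ▸ hU) h3
      refine ⟨C, hC, hC', ?_⟩
      rwa [hb, Finset.inter_eq_left.2 hC]
    push Not at h3
    obtain ⟨v, hv, hv3⟩ := h3
    have hv2 := (h v hv).resolve_right hv3
    obtain ⟨a, b, hab, hN⟩ := Finset.card_eq_two.1 hv2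
    have ha : a ∈ S ∧ K.Adj v a := by
      have : a ∈ S.filter (K.Adj v) := by simp [hN]
      simpa using this
    have hb : b ∈ S ∧ K.Adj v b := by
      have : b ∈ S.filter (K.Adj v) := by simp [hN]
      simpa using this
    have hvb : v ∉ branch K S := by simp [branch, hv3]
    -- If the neighbours of `v` are adjacent, the triangle is a carrier with at most two branch
    -- vertices. Otherwise suppressing `v` leaves the branch set unchanged.
    by_cases hadj : K.Adj a b
    · refine ⟨{v, a, b}, ?_, ⟨⟨v, by simp⟩, ?_⟩, ?_⟩
      · simp [Finset.insert_subset_iff, hv, ha.1, hb.1]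
      · intro w hw
        simp only [Finset.mem_insert, Finset.mem_singleton] at hw
        rcases hw with rfl | rfl | rfl
        · exact two_le_degIn K (y := a) (z := b) (by simp) (by simp) hab ha.2 hb.2
        · exact two_le_degIn K (y := v) (z := b) (by simp) (by simp) hb.2.ne ha.2.symm hadj
        · exact two_le_degIn K (y := v) (z := a) (by simp) (by simp) ha.2.ne hb.2.symm hadj.symm
      · have h1 : ({v, a, b} : Finset V) ∩ branch K S ⊆ {a, b} := by
          intro x hx
          simp only [Finset.mem_inter, Finset.mem_insert, Finset.mem_singleton] at hx ⊢
          rcases hx with ⟨rfl | h, h'⟩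
          · exact absurd h' hvb
          · exact h
        have h2 := (Finset.card_le_card h1).trans Finset.card_le_two
        have h3 : (0 : ℝ) ≤ Real.logb 2 (branch K S).card :=
          Real.logb_nonneg (by norm_num) (by exact_mod_cast hU.card_pos)
        have h4 : ((({v, a, b} : Finset V) ∩ branch K S).card : ℝ) ≤ 2 := by exact_mod_cast h2
        linarith
    · have hva : v ≠ a := ha.2.ne
      have hvb' : v ≠ b := hb.2.ne
      have hdeg : ∀ w ∈ S.erase v,
          degIn (K ⊔ SimpleGraph.edge a b) (S.erase v) w = degIn K S w := by
        intro w hw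
        rw [degIn_sup_edge K hab hN hadj (Finset.erase_subset _ _) (by simp)
          (by simp [ha.1, hva.symm]) (by simp [hb.1, hvb'.symm]) hw, Finset.insert_erase hv]
      have hbr : branch (K ⊔ SimpleGraph.edge a b) (S.erase v) = branch K S := by
        ext w
        simp only [branch, Finset.mem_filter]
        constructor
        · rintro ⟨h1, h2⟩
          exact ⟨Finset.mem_of_mem_erase h1, hdeg w h1 ▸ h2⟩
        · rintro ⟨h1, h2⟩
          have h3 : w ∈ S.erase v := Finset.mem_erase.2 ⟨by rintro rfl; exact hv3 h2, h1⟩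
          exact ⟨h3, (hdeg w h3).trans h2⟩
      obtain ⟨C, hC, hC', hc⟩ := ih (K ⊔ SimpleGraph.edge a b) (S.erase v)
        (fun w hw => by rw [hdeg w hw]; exact h w (Finset.mem_of_mem_erase hw))
        (by rwa [hbr]) (by rw [Finset.card_erase_of_mem hv]; omega)
      rw [hbr] at hc
      have hvC : v ∉ C := fun h => by simpa using hC h
      have hCS : C ⊆ S := hC.trans (Finset.erase_subset _ _)
      -- A carrier of the suppressed graph can use the edge `ab` only if it contains both ends; then
      -- `v` is put back, which adds no branch vertex.
      by_cases hboth : a ∈ C ∧ b ∈ C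
      · refine ⟨insert v C, Finset.insert_subset hv hCS, ⟨⟨v, by simp⟩, ?_⟩, ?_⟩
        · intro w hw
          rcases Finset.mem_insert.1 hw with rfl | hw
          · exact two_le_degIn K (y := a) (z := b) (by simp [hboth]) (by simp [hboth]) hab
              ha.2 hb.2
          · rw [← degIn_sup_edge K hab hN hadj hCS hvC hboth.1 hboth.2 hw]
            exact hC'.2 w hw
        · rwa [Finset.insert_inter_of_notMem hvb]
      · refine ⟨C, hCS, ⟨hC'.1, fun w hw => ?_⟩, hc⟩
        have : C.filter ((K ⊔ SimpleGraph.edge a b).Adj w) = C.filter (K.Adj w) := by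
          ext x
          simp only [Finset.mem_filter, SimpleGraph.sup_adj, SimpleGraph.edge_adj]
          grind
        have h2 := hC'.2 w hw
        rwa [degIn_eq_card, this, ← degIn_eq_card] at h2

/-! ### Families of disjoint carriers -/

/-- `S` contains `k` pairwise disjoint carriers. -/
def HasCarriers (K : SimpleGraph V) (S : Finset V) (k : ℕ) : Prop :=
  ∃ L : List (Finset V), L.length = k ∧ L.Pairwise Disjoint ∧ ∀ C ∈ L, C ⊆ S ∧ IsCarrier K C

lemma HasCarriers.mono {K : SimpleGraph V} {S T : Finset V} {k : ℕ} (h : HasCarriers K S k)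
    (hST : S ⊆ T) : HasCarriers K T k := by
  obtain ⟨L, h1, h2, h3⟩ := h
  exact ⟨L, h1, h2, fun C hC => ⟨(h3 C hC).1.trans hST, (h3 C hC).2⟩⟩

lemma IsCarrier.mono_graph {K L : SimpleGraph V} {C : Finset V} (h : IsCarrier K C)
    (hKL : K ≤ L) : IsCarrier L C :=
  ⟨h.1, fun v hv => (h.2 v hv).trans (degIn_mono_graph hKL C v)⟩

lemma HasCarriers.mono_graph {K L : SimpleGraph V} {S : Finset V} {k : ℕ}
    (h : HasCarriers K S k) (hKL : K ≤ L) : HasCarriers L S k := by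
  obtain ⟨F, h1, h2, h3⟩ := h
  exact ⟨F, h1, h2, fun C hC => ⟨(h3 C hC).1, (h3 C hC).2.mono_graph hKL⟩⟩

lemma hasCarriers_zero (K : SimpleGraph V) (S : Finset V) : HasCarriers K S 0 :=
  ⟨[], rfl, List.Pairwise.nil, by simp⟩

lemma HasCarriers.cons {K : SimpleGraph V} {S T C : Finset V} {k : ℕ} (h : HasCarriers K S k)
    (hST : S ⊆ T) (hC : IsCarrier K C) (hCT : C ⊆ T) (hd : Disjoint S C) :
    HasCarriers K T (k + 1) := by
  obtain ⟨L, h1, h2, h3⟩ := h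
  refine ⟨C :: L, by simp [h1], List.pairwise_cons.2 ⟨fun D hD => ?_, h2⟩, ?_⟩
  · exact (Finset.disjoint_of_subset_left (h3 D hD).1 hd).symm
  · intro D hD
    rcases List.mem_cons.1 hD with rfl | hD
    · exact ⟨hCT, hC⟩
    · exact ⟨(h3 D hD).1.trans hST, (h3 D hD).2⟩

/-! ### Estimates for `sSeq` -/

lemma one_le_logb_two {x : ℝ} (hx : 2 ≤ x) : 1 ≤ Real.logb 2 x := by
  rw [Real.le_logb_iff_rpow_le (by norm_num) (by linarith)]
  simpa using hx

lemma sSeq_of_two_le {k : ℕ} (hk : 2 ≤ k) : sSeq k = 4 * k *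
    (Real.logb 2 k + Real.logb 2 (Real.logb 2 k) + 4) := by
  rw [sSeq, if_pos hk]; ring

lemma logb_logb_nonneg {k : ℕ} (hk : 2 ≤ k) : 0 ≤ Real.logb 2 (Real.logb 2 k) :=
  Real.logb_nonneg (by norm_num) (one_le_logb_two (by exact_mod_cast hk))

lemma sSeq_lower {k : ℕ} (hk : 2 ≤ k) : 20 * (k : ℝ) ≤ sSeq k := by
  rw [sSeq_of_two_le hk]
  have h1 := one_le_logb_two (x := k) (by exact_mod_cast hk)
  have h2 := logb_logb_nonneg hk
  have : (0 : ℝ) ≤ k := by positivity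
  nlinarith

/-- The derivative of `x - 4 * log₂ x` is nonnegative from `4 / log 2 ≈ 5.77` on, whence the
threshold 6. The inequality `log t ≤ t - 1` replaces calculus. -/
lemma sub_logb_mono {s n : ℝ} (hs : 6 ≤ s) (hn : s ≤ n) :
    s - 4 * Real.logb 2 s ≤ n - 4 * Real.logb 2 n := by
  have h1 : Real.log (n / s) ≤ n / s - 1 :=
    Real.log_le_sub_one_of_pos (div_pos (by linarith) (by linarith))
  rw [Real.log_div (by linarith) (by linarith)] at h1
  have h2 : n / s - 1 = (n - s) / s := by field_simp
  have h3 : (n - s) / s ≤ (n - s) / 6 :=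
    div_le_div_of_nonneg_left (by linarith) (by norm_num) hs
  have h4 := Real.log_two_gt_d9
  have h5 : Real.logb 2 n - Real.logb 2 s ≤ (n - s) / 4 := by
    rw [Real.logb, Real.logb, ← sub_div, div_le_iff₀ (by linarith)]
    nlinarith
  linarith

/-- Concavity: `log₂` lies below its tangent at 2, and `log₂ k ≥ 11/7` because `2 ^ 11 ≤ 3 ^ 7`. The
inequality fails for `k = 2`. -/
lemma logb_logb_add_four_le {k : ℕ} (hk : 3 ≤ k) :
    Real.logb 2 (Real.logb 2 k) + 4 ≤ 3 * Real.logb 2 k := by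
  have ha : (11 / 7 : ℝ) ≤ Real.logb 2 k := by
    have h1 : (11 : ℝ) ≤ Real.logb 2 ((k : ℝ) ^ 7) := by
      rw [Real.le_logb_iff_rpow_le (by norm_num) (by positivity)]
      have : (3 : ℝ) ^ 7 ≤ (k : ℝ) ^ 7 :=
        pow_le_pow_left₀ (by norm_num) (by exact_mod_cast hk) 7
      have e : (2 : ℝ) ^ (11 : ℝ) = 2 ^ (11 : ℕ) := by
        rw [← Real.rpow_natCast]; norm_num
      rw [e]
      linarith
    rw [Real.logb_pow] at h1
    push_cast at h1
    linarith
  set a := Real.logb 2 (k : ℝ)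
  have h1 : Real.log (a / 2) ≤ a / 2 - 1 := Real.log_le_sub_one_of_pos (by linarith)
  rw [Real.log_div (by linarith) (by norm_num)] at h1
  have h4 := Real.log_two_gt_d9
  have h5 := Real.log_two_lt_d9
  have h6 : Real.logb 2 a ≤ 3 * a - 4 := by
    rw [Real.logb, div_le_iff₀ (by linarith)]
    rcases le_total 0 (3 * a - 5) with h | h <;> nlinarith
  linarith

lemma logb_sSeq_le {k : ℕ} (hk : 3 ≤ k) :
    Real.logb 2 (sSeq k) ≤ Real.logb 2 k + Real.logb 2 (Real.logb 2 k) + 4 := by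
  have h1 := one_le_logb_two (x := k) (by exact_mod_cast (by omega : 2 ≤ k))
  have h2 := logb_logb_add_four_le hk
  have h3 := logb_logb_nonneg (k := k) (by omega)
  have hk0 : (0 : ℝ) < k := by exact_mod_cast (by omega : 0 < k)
  have h4 : sSeq k ≤ 2 ^ 4 * (k : ℝ) * Real.logb 2 k := by
    rw [sSeq_of_two_le (by omega)]
    nlinarith
  have h5 : Real.logb 2 (sSeq k) ≤ Real.logb 2 (2 ^ 4 * (k : ℝ) * Real.logb 2 k) :=
    Real.logb_le_logb_of_le (by norm_num) (by have := sSeq_lower (k := k) (by omega); linarith) h4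
  rw [Real.logb_mul (by positivity) (by linarith), Real.logb_mul (by norm_num) (by positivity),
    Real.logb_pow, Real.logb_self_eq_one (by norm_num)] at h5
  push_cast at h5
  linarith

lemma one_le_mul_logb_sub {m : ℕ} (hm : 1 ≤ m) :
    1 ≤ (m : ℝ) * (Real.logb 2 ((m + 1 : ℕ) : ℝ) - Real.logb 2 m) := by
  have hm0 : (0 : ℝ) < m := by exact_mod_cast hm
  rw [← Real.logb_div (by positivity) (by positivity), ← Real.logb_pow]
  refine one_le_logb_two ?_
  have h1 := one_add_mul_le_pow (a := (1 / m : ℝ)) (by have : (0 : ℝ) ≤ 1 / m := by positivity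
                                                       linarith) m
  have h2 : (((m + 1 : ℕ) : ℝ) / m) = 1 + 1 / m := by push_cast; field_simp
  rw [h2]
  have h3 : (m : ℝ) * (1 / m) = 1 := by field_simp
  linarith

/-- The amount subtracted is what pruning may cost when a carrier with at most `2 * log₂ n + 2`
branch vertices is removed. By monotonicity `n = sSeq (m + 1)` is the worst case. Writing `sSeq k =
4 * k * L k`, for `m ≥ 2` one has `log₂ (sSeq (m + 1)) ≤ L (m + 1)`, so `4 * m * L (m + 1) - 4`
remains. This is at least `4 * m * L m`, as `(1 + 1/m) ^ m ≥ 2`. -/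
lemma sSeq_step {m : ℕ} (hm : 1 ≤ m) {n : ℝ} (hn : sSeq (m + 1) ≤ n) :
    sSeq m ≤ n - 2 * (2 * Real.logb 2 n + 2) := by
  have h0 := sSeq_lower (k := m + 1) (by omega)
  push_cast at h0
  have hm' : (1 : ℝ) ≤ m := by exact_mod_cast hm
  have h1 := sub_logb_mono (by linarith) hn
  -- The logarithmic bound on `sSeq (m + 1)` needs `m + 1 ≥ 3`, so `m = 1` is checked numerically
  -- with `sSeq 2 = 40`.
  rcases hm.eq_or_lt with rfl | hm
  · have e : sSeq (1 + 1) = 40 := by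
      rw [sSeq_of_two_le (by norm_num)]
      norm_num
    have e1 : sSeq 1 = 1 := by simp [sSeq]
    have h2 : Real.logb 2 (40 : ℝ) ≤ 6 := by
      rw [Real.logb_le_iff_le_rpow (by norm_num) (by norm_num)]
      have : (2 : ℝ) ^ (6 : ℝ) = 2 ^ (6 : ℕ) := by rw [← Real.rpow_natCast]; norm_num
      rw [this]; norm_num
    rw [e] at h1
    rw [e1]
    linarith
  · have h2 := logb_sSeq_le (k := m + 1) (by omega)
    have h3 := one_le_mul_logb_sub (m := m) (by omega)
    have h4 : Real.logb 2 (Real.logb 2 m) ≤ Real.logb 2 (Real.logb 2 ((m + 1 : ℕ) : ℝ)) := by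
      have := one_le_logb_two (x := m) (by exact_mod_cast hm)
      refine Real.logb_le_logb_of_le (by norm_num) (by linarith) ?_
      exact Real.logb_le_logb_of_le (by norm_num) (by linarith) (by push_cast; linarith)
    rw [sSeq_of_two_le (by omega : 2 ≤ m)]
    rw [sSeq_of_two_le (by omega : 2 ≤ m + 1)] at h1 h2
    push_cast at *
    nlinarith

/-! ### Many branch vertices force many disjoint carriers -/

/-- A graph with all degrees two or three and at least `sSeq k` branch vertices contains `k`
disjoint carriers. -/
theorem hasCarriers_of_sSeq_le (K : SimpleGraph V) (k : ℕ) (S : Finset V)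
    (h : ∀ v ∈ S, degIn K S v = 2 ∨ degIn K S v = 3) (hk : sSeq k ≤ (branch K S).card) :
    HasCarriers K S k := by
  induction k generalizing S with
  | zero => exact hasCarriers_zero K S
  | succ m ih =>
    have hne : (branch K S).Nonempty := by
      rw [Finset.nonempty_iff_ne_empty]
      intro he
      rw [he, Finset.card_empty] at hk
      rcases Nat.eq_zero_or_pos m with rfl | hm
      · norm_num [sSeq] at hk
      · have := sSeq_lower (k := m + 1) (by omega)
        push_cast at this hk
        have : (0 : ℝ) ≤ m := by positivity
        linarith
    rcases Nat.eq_zero_or_pos m with rfl | hm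
    · refine (hasCarriers_zero K ∅).cons (C := S) (by simp) ⟨hne.mono (branch_subset K S), ?_⟩
        subset_rfl (by simp)
      intro v hv
      rcases h v hv with h | h <;> omega
    · obtain ⟨C, hC, hC', hc⟩ := exists_carrier_few_branch K S h hne
      obtain ⟨S', hS', hd, hdeg, hle⟩ := exists_prune K hC h hC'
      have h1 := sSeq_step hm hk
      have h2 : ((branch K S).card : ℝ) ≤ (branch K S').card + 2 * (C ∩ branch K S).card := by
        exact_mod_cast hle
      exact (ih S' hdeg (by linarith)).cons hS' hC' hC hd

/-! ### Maximal paths and linear layouts -/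

/-- A maximal path in a finite vertex set. -/
lemma exists_maximal_path (K : SimpleGraph V) {Z : Finset V} (hZ : Z.Nonempty) :
    ∃ (n : ℕ) (g : ℕ → V), (∀ i ≤ n, g i ∈ Z) ∧ Set.InjOn g {i | i ≤ n} ∧
      (∀ i < n, K.Adj (g i) (g (i + 1))) ∧
      (∀ w ∈ Z, K.Adj w (g 0) → ∃ j ≤ n, g j = w) ∧
      (∀ w ∈ Z, K.Adj w (g n) → ∃ j ≤ n, g j = w) := by
  have : Nonempty (Z : Set V) := hZ.to_subtype
  obtain ⟨u, v, p, hp, hmax⟩ :=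
    SimpleGraph.Walk.exists_isPath_forall_isPath_length_le_length (K.induce (Z : Set V))
  refine ⟨p.length, fun i => (p.getVert i : V), fun i _ => (p.getVert i).2, ?_, ?_, ?_, ?_⟩
  · intro i hi j hj hij
    exact hp.getVert_injOn hi hj (Subtype.ext hij)
  · intro i hi
    exact p.adj_getVert_succ hi
  · intro w hw hadj
    by_contra hcon
    push Not at hcon
    have hadj' : (K.induce (Z : Set V)).Adj ⟨w, hw⟩ u := by simpa using hadj
    have hn : (⟨w, hw⟩ : (Z : Set V)) ∉ p.support := fun h => by
      obtain ⟨i, hi, hle⟩ := SimpleGraph.Walk.mem_support_iff_exists_getVert.1 h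
      exact hcon i hle (congrArg Subtype.val hi)
    have := hmax _ _ (p.cons hadj') (hp.cons hn)
    simp at this
  · intro w hw hadj
    by_contra hcon
    push Not at hcon
    have hadj' : (K.induce (Z : Set V)).Adj v ⟨w, hw⟩ := by simpa using hadj.symm
    have hn : (⟨w, hw⟩ : (Z : Set V)) ∉ p.support := fun h => by
      obtain ⟨i, hi, hle⟩ := SimpleGraph.Walk.mem_support_iff_exists_getVert.1 h
      exact hcon i hle (congrArg Subtype.val hi)
    have := hmax _ _ (p.concat hadj') (hp.concat hn hadj')
    simp at this

/-- In an acyclic graph the first vertex of a longest path has no neighbour other than the second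
vertex, which contradicts degree two. -/
lemma exists_isCycle_of_isCarrier {K : SimpleGraph V} {C : Finset V} (hC : IsCarrier K C) :
    ∃ (v : V) (c : K.Walk v v), c.IsCycle ∧ ∀ z ∈ c.support, z ∈ C := by
  have hna : ¬ (K.induce (C : Set V)).IsAcyclic := by
    intro hac
    have : Nonempty (C : Set V) := hC.1.to_subtype
    obtain ⟨u, v, p, hp, hmax⟩ :=
      SimpleGraph.Walk.exists_isPath_forall_isPath_length_le_length (K.induce (C : Set V))
    obtain ⟨a, ha, b, hb, hab⟩ := Finset.one_lt_card.1 (hC.2 u u.2)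
    simp only [Finset.mem_filter] at ha hb
    have key : ∀ w (hw : w ∈ C), K.Adj u w → (⟨w, hw⟩ : (C : Set V)) = p.snd := by
      intro w hw hadj
      have hadj' : (K.induce (C : Set V)).Adj u ⟨w, hw⟩ := by simpa using hadj
      refine hac.eq_snd_of_adj_start hp hadj' ?_
      by_contra hn
      have := hmax _ _ (p.cons hadj'.symm) (hp.cons hn)
      simp at this
    have h1 := (key a ha.1 ha.2).trans (key b hb.1 hb.2).symm
    exact hab (congrArg Subtype.val h1)
  simp only [SimpleGraph.IsAcyclic, not_forall, not_not] at hna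
  obtain ⟨v, c, hc⟩ := hna
  refine ⟨(SimpleGraph.Embedding.induce (C : Set V)).toHom v,
    c.map (SimpleGraph.Embedding.induce (C : Set V)).toHom,
    hc.map Subtype.val_injective, ?_⟩
  intro z hz
  rw [SimpleGraph.Walk.support_map, List.mem_map] at hz
  obtain ⟨y, -, rfl⟩ := hz
  exact y.2

lemma eq_or_eq_of_degIn_le_two {K : SimpleGraph V} {Z : Finset V} {v a b w : V}
    (h : degIn K Z v ≤ 2) (ha : a ∈ Z) (hb : b ∈ Z) (hw : w ∈ Z) (hab : a ≠ b)
    (hva : K.Adj v a) (hvb : K.Adj v b) (hvw : K.Adj v w) : w = a ∨ w = b := by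
  by_contra hcon
  push Not at hcon
  have h1 : ({w, a, b} : Finset V) ⊆ Z.filter (K.Adj v) := by
    simp [Finset.insert_subset_iff, ha, hb, hw, hva, hvb, hvw]
  have h2 := Finset.card_le_card h1
  rw [Finset.card_eq_three.2 ⟨w, a, b, hcon.1, hcon.2, hab, rfl⟩, ← degIn_eq_card] at h2
  omega

/-- Adjacency along a maximal path in a graph of maximum degree two. -/
lemma adj_maximal_path {K : SimpleGraph V} {Z : Finset V} (hdeg : ∀ v ∈ Z, degIn K Z v ≤ 2)
    {n : ℕ} {g : ℕ → V} (hg : ∀ i ≤ n, g i ∈ Z) (hinj : Set.InjOn g {i | i ≤ n})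
    (hadj : ∀ i < n, K.Adj (g i) (g (i + 1)))
    (h0 : ∀ w ∈ Z, K.Adj w (g 0) → ∃ j ≤ n, g j = w)
    (hn : ∀ w ∈ Z, K.Adj w (g n) → ∃ j ≤ n, g j = w)
    {i : ℕ} (hi : i ≤ n) {w : V} (hw : w ∈ Z) (h : K.Adj (g i) w) :
    ∃ j ≤ n, g j = w ∧ (j = i + 1 ∨ i = j + 1 ∨ (2 ≤ n ∧ K.Adj (g n) (g 0) ∧
      ((i = 0 ∧ j = n) ∨ (i = n ∧ j = 0)))) := by
  have hint : ∀ m, 0 < m → m < n → ∀ w ∈ Z, K.Adj (g m) w → w = g (m - 1) ∨ w = g (m + 1) := by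
    intro m hm0 hmn w hw hmw
    have e : m - 1 + 1 = m := by omega
    have h1 := hadj (m - 1) (by omega)
    rw [e] at h1
    refine eq_or_eq_of_degIn_le_two (hdeg _ (hg m (by omega))) (hg _ (by omega))
      (hg _ (by omega)) hw ?_ h1.symm (hadj m hmn) hmw
    intro h2
    have := hinj (show m - 1 ≤ n by omega) (show m + 1 ≤ n by omega) h2
    omega
  have hback : ∀ m, 0 < m → m < n → ∀ k ≤ n, K.Adj (g m) (g k) → k = m - 1 ∨ k = m + 1 := by
    intro m hm0 hmn k hk hmk
    rcases hint m hm0 hmn _ (hg k hk) hmk with h | h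
    · exact Or.inl (hinj (show k ≤ n from hk) (show m - 1 ≤ n by omega) h)
    · exact Or.inr (hinj (show k ≤ n from hk) (show m + 1 ≤ n by omega) h)
  have hj : ∃ j ≤ n, g j = w := by
    rcases Nat.eq_zero_or_pos i with rfl | hi0
    · exact h0 w hw h.symm
    rcases hi.eq_or_lt with rfl | hin
    · exact hn w hw h.symm
    rcases hint i hi0 hin w hw h with h | h
    · exact ⟨i - 1, by omega, h.symm⟩
    · exact ⟨i + 1, by omega, h.symm⟩
  obtain ⟨j, hj, rfl⟩ := hj
  refine ⟨j, hj, rfl, ?_⟩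
  have hij : i ≠ j := by
    rintro rfl
    exact K.loopless.irrefl _ h
  by_cases hi1 : 0 < i ∧ i < n
  · have := hback i hi1.1 hi1.2 j hj h
    omega
  by_cases hj1 : 0 < j ∧ j < n
  · have := hback j hj1.1 hj1.2 i hi h.symm
    omega
  by_cases h2 : 2 ≤ n
  · right; right
    have h3 : (i = 0 ∧ j = n) ∨ (i = n ∧ j = 0) := by omega
    refine ⟨h2, ?_, h3⟩
    rcases h3 with ⟨rfl, rfl⟩ | ⟨rfl, rfl⟩
    · exact h.symm
    · exact h
  · omega

lemma mem_support_iff_of_closed {K : SimpleGraph V} {Z Q : Finset V}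
    (hQ : ∀ x ∈ Z, ∀ y ∈ Z, K.Adj x y → (x ∈ Q ↔ y ∈ Q)) {x y : V} (p : K.Walk x y)
    (hp : ∀ z ∈ p.support, z ∈ Z) : ∀ z ∈ p.support, (z ∈ Q ↔ x ∈ Q) := by
  induction p with
  | nil => simp
  | cons h p ih =>
    have hp' : ∀ z ∈ p.support, z ∈ Z := fun z hz => hp z (by simp [hz])
    have := hQ _ (hp _ (by simp)) _ (hp' _ p.start_mem_support) h
    intro z hz
    rw [SimpleGraph.Walk.support_cons, List.mem_cons] at hz
    rcases hz with rfl | hz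
    · rfl
    · rw [ih hp' z hz, this]

/-- A finite graph of maximum degree two can be laid out on a line so that short walks have short
extent, after removing `w` vertices for each of a family of disjoint carriers. -/
lemma exists_arrangement (K : SimpleGraph V) (w : ℕ) (Z : Finset V)
    (hdeg : ∀ v ∈ Z, degIn K Z v ≤ 2) :
    ∃ (m : ℕ) (Y : Finset V) (pos : V → ℕ), HasCarriers K Z m ∧ Y.card ≤ m * w ∧
      Set.InjOn pos Z ∧ ∀ (x y : V) (p : K.Walk x y), (∀ z ∈ p.support, z ∈ Z) →
        x ∉ Y → y ∉ Y → p.length ≤ w → pos x ≤ pos y + p.length := by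
  induction hc : Z.card using Nat.strong_induction_on generalizing Z with
  | _ c ih =>
    subst hc
    rcases Z.eq_empty_or_nonempty with rfl | hZ
    · exact ⟨0, ∅, fun _ => 0, hasCarriers_zero K _, by simp, by simp, by simp⟩
    obtain ⟨n, g, hg, hinj, hadj, h0, hn⟩ := exists_maximal_path K hZ
    set Q := (Finset.range (n + 1)).image g with hQdef
    have hQ : ∀ x, x ∈ Q ↔ ∃ i ≤ n, g i = x := by simp [hQdef]
    have hQZ : Q ⊆ Z := by
      intro x hx
      obtain ⟨i, hi, rfl⟩ := (hQ x).1 hx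
      exact hg i hi
    have hstep := @adj_maximal_path V K Z hdeg n g hg hinj hadj h0 hn
    have hQcl : ∀ x ∈ Z, ∀ y ∈ Z, K.Adj x y → (x ∈ Q ↔ y ∈ Q) := by
      have : ∀ x ∈ Z, ∀ y ∈ Z, K.Adj x y → x ∈ Q → y ∈ Q := by
        intro x _ y hy hxy hxQ
        obtain ⟨i, hi, rfl⟩ := (hQ x).1 hxQ
        obtain ⟨j, hj, rfl, -⟩ := hstep hi hy hxy
        exact (hQ _).2 ⟨j, hj, rfl⟩
      exact fun x hx y hy hxy => ⟨this x hx y hy hxy, this y hy x hx hxy.symm⟩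
    have hlt : (Z \ Q).card < Z.card := by
      have h1 := Finset.card_sdiff_add_card_eq_card hQZ
      have h2 : 0 < Q.card := Finset.card_pos.2 ⟨g 0, (hQ _).2 ⟨0, by omega, rfl⟩⟩
      omega
    obtain ⟨m, Y, pos, hm, hY, hpos, hwalk⟩ := ih _ hlt (Z \ Q)
      (fun v hv => (degIn_mono K Finset.sdiff_subset v).trans
        (hdeg v (Finset.mem_sdiff.1 hv).1)) rfl
    obtain ⟨idx, hidx⟩ : ∃ idx : V → ℕ, ∀ i ≤ n, idx (g i) = i :=
      ⟨Function.invFunOn g {i | i ≤ n}, fun i hi => hinj.leftInvOn_invFunOn hi⟩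
    -- Along the component `Q` a walk either changes the index by at most its length or goes round
    -- the closing edge, which costs at least `n + 1` minus the index difference.
    have hwalkQ : ∀ (x y : V) (p : K.Walk x y), (∀ z ∈ p.support, z ∈ Z) → x ∈ Q →
        (idx x ≤ idx y + p.length ∧ idx y ≤ idx x + p.length) ∨
        ((2 ≤ n ∧ K.Adj (g n) (g 0)) ∧
          (n + 1 + idx y ≤ idx x + p.length ∨ n + 1 + idx x ≤ idx y + p.length)) := by
      intro x y p
      induction p with
      | nil => intro _ _; left; simp
      | @cons a b y h p ihp =>
        intro hp ha
        obtain ⟨i, hi, rfl⟩ := (hQ a).1 ha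
        have hp' : ∀ z ∈ p.support, z ∈ Z := fun z hz => hp z (by simp [hz])
        obtain ⟨j, hj, rfl, hij⟩ := hstep hi (hp' _ p.start_mem_support) h
        have h1 := ihp hp' ((hQ _).2 ⟨j, hj, rfl⟩)
        obtain ⟨k, hk, rfl⟩ := (hQ y).1 ((mem_support_iff_of_closed hQcl p hp' y
          p.end_mem_support).2 ((hQ _).2 ⟨j, hj, rfl⟩))
        rw [hidx j hj, hidx k hk] at h1
        rw [hidx i hi, hidx k hk, SimpleGraph.Walk.length_cons]
        rcases hij with h2 | h2 | ⟨h2, h3, h4⟩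
        · rcases h1 with h1 | ⟨h1, h1'⟩
          · left; omega
          · right; exact ⟨h1, by omega⟩
        · rcases h1 with h1 | ⟨h1, h1'⟩
          · left; omega
          · right; exact ⟨h1, by omega⟩
        · simp only [h2, h3, true_and, and_self] at h1 ⊢
          omega
    -- `Q` occupies positions `0` to `n`; the layout of the rest is shifted past it.
    set pos' : V → ℕ := fun v => if v ∈ Q then idx v else n + 1 + pos v with hpos'
    have hinj' : Set.InjOn pos' Z := by
      have hQidx : ∀ x ∈ Q, g (idx x) = x ∧ idx x ≤ n := by
        intro x hx
        obtain ⟨i, hi, rfl⟩ := (hQ x).1 hx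
        rw [hidx i hi]
        exact ⟨rfl, hi⟩
      intro x hx y hy hxy
      simp only [hpos'] at hxy
      by_cases hxQ : x ∈ Q <;> by_cases hyQ : y ∈ Q <;>
        simp only [hxQ, hyQ, if_true, if_false] at hxy
      · rw [← (hQidx x hxQ).1, hxy, (hQidx y hyQ).1]
      · have := (hQidx x hxQ).2
        omega
      · have := (hQidx y hyQ).2
        omega
      · exact hpos (Finset.mem_coe.2 (Finset.mem_sdiff.2 ⟨hx, hxQ⟩))
          (Finset.mem_coe.2 (Finset.mem_sdiff.2 ⟨hy, hyQ⟩)) (by omega)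
    have hout : ∀ (x y : V) (p : K.Walk x y), (∀ z ∈ p.support, z ∈ Z) → x ∉ Y → y ∉ Y →
        p.length ≤ w → x ∉ Q → pos' x ≤ pos' y + p.length := by
      intro x y p hp hx hy hw hxQ
      have hcl := mem_support_iff_of_closed hQcl p hp
      have hyQ : y ∉ Q := fun h => hxQ ((hcl y p.end_mem_support).1 h)
      have := hwalk x y p (fun z hz => Finset.mem_sdiff.2 ⟨hp z hz, fun h =>
        hxQ ((hcl z hz).1 h)⟩) hx hy hw
      simp only [hpos', hxQ, hyQ, if_false]
      omega
    have hinQ : ∀ (x y : V) (p : K.Walk x y), (∀ z ∈ p.support, z ∈ Z) → x ∈ Q → y ∈ Q :=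
      fun x y p hp hx => (mem_support_iff_of_closed hQcl p hp y p.end_mem_support).2 hx
    -- If `Q` is a cycle, its first `w` indices go into the removed set. Two remaining indices
    -- differ by at most `n - w`, so going round takes more than `w` steps. Only the ends of the
    -- walk need to avoid the removed set.
    by_cases hwrap : 2 ≤ n ∧ K.Adj (g n) (g 0)
    · refine ⟨m + 1, (Finset.range w).image g ∪ Y, pos', ?_, ?_, hinj', ?_⟩
      · refine hm.cons (C := Q) Finset.sdiff_subset ⟨⟨g 0, (hQ _).2 ⟨0, by omega, rfl⟩⟩, ?_⟩ hQZ
          Finset.sdiff_disjoint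
        intro v hv
        obtain ⟨i, hi, rfl⟩ := (hQ v).1 hv
        obtain ⟨a, ha, b, hb, hab, hia, hib⟩ : ∃ a ≤ n, ∃ b ≤ n, a ≠ b ∧ K.Adj (g i) (g a) ∧
            K.Adj (g i) (g b) := by
          rcases Nat.eq_zero_or_pos i with rfl | hi0
          · exact ⟨1, by omega, n, le_rfl, by omega, hadj 0 (by omega), hwrap.2.symm⟩
          have e : i - 1 + 1 = i := by omega
          have h1 := hadj (i - 1) (by omega)
          rw [e] at h1
          rcases hi.eq_or_lt with rfl | hin
          · exact ⟨i - 1, by omega, 0, by omega, by omega, h1.symm, hwrap.2⟩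
          · exact ⟨i - 1, by omega, i + 1, by omega, by omega, h1.symm, hadj i hin⟩
        exact two_le_degIn K ((hQ _).2 ⟨a, ha, rfl⟩) ((hQ _).2 ⟨b, hb, rfl⟩)
          (fun h => hab (hinj ha hb h)) hia hib
      · refine (Finset.card_union_le _ _).trans ?_
        have := (Finset.card_image_le (s := Finset.range w) (f := g))
        rw [Finset.card_range] at this
        rw [add_mul, one_mul]
        omega
      · intro x y p hp hx hy hw
        simp only [Finset.mem_union, Finset.mem_image, Finset.mem_range, not_or, not_exists,
          not_and] at hx hy
        by_cases hxQ : x ∈ Q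
        · have hyQ := hinQ x y p hp hxQ
          have h1 := hwalkQ x y p hp hxQ
          simp only [hpos', hxQ, hyQ, if_true]
          obtain ⟨i, hi, rfl⟩ := (hQ x).1 hxQ
          obtain ⟨j, hj, rfl⟩ := (hQ y).1 hyQ
          have h2 : w ≤ i := by
            by_contra h
            exact hx.1 i (by omega) rfl
          have h3 : w ≤ j := by
            by_contra h
            exact hy.1 j (by omega) rfl
          rw [hidx i hi, hidx j hj] at *
          omega
        · exact hout x y p hp hx.2 hy.2 hw hxQ
    · refine ⟨m, Y, pos', hm.mono Finset.sdiff_subset, hY, hinj', ?_⟩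
      intro x y p hp hx hy hw
      by_cases hxQ : x ∈ Q
      · have hyQ := hinQ x y p hp hxQ
        have h1 := hwalkQ x y p hp hxQ
        simp only [hpos', hxQ, hyQ, if_true]
        rcases h1 with h1 | h1
        · exact h1.1
        · exact absurd h1.1 hwrap
      · exact hout x y p hp hx hy hw hxQ

/-! ### Separation and hitting on the line -/

/-- Greedy selection of separated members of a family of sets of naturals without long gaps,
together with few windows meeting all members. -/
lemma exists_separated_and_hitting {w : ℕ} (hw : 0 < w) (n lo : ℕ) (T : Set (Set ℕ))
    (hne : ∀ A ∈ T, A.Nonempty)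
    (hgap : ∀ A ∈ T, ∀ a ∈ A, ∀ b ∈ A, ∀ c, a < c → c + w ≤ b → ∃ x ∈ A, c ≤ x ∧ x < c + w)
    (hlo : ∀ A ∈ T, ∀ x ∈ A, lo ≤ x) (hhi : ∀ A ∈ T, ∀ x ∈ A, x < lo + n) :
    ∃ (L : List (Set ℕ)) (W : Finset ℕ), (∀ A ∈ L, A ∈ T) ∧
      L.Pairwise (fun A B => ∀ a ∈ A, ∀ b ∈ B, a + w ≤ b) ∧ W.card ≤ L.length * w ∧
      ∀ A ∈ T, ∃ x ∈ A, x ∈ W := by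
  induction n using Nat.strong_induction_on generalizing lo T with
  | _ n ih =>
    by_cases hT : ∃ A, A ∈ T
    swap
    · refine ⟨[], ∅, by simp, List.Pairwise.nil, by simp, fun A hA => absurd ⟨A, hA⟩ hT⟩
    have hex : ∃ M, ∃ A ∈ T, ∀ x ∈ A, x ≤ M := by
      obtain ⟨A, hA⟩ := hT
      exact ⟨lo + n, A, hA, fun x hx => (hhi A hA x hx).le⟩
    -- `M` is the least maximum of a member. Every member reaches `M` or beyond, so one missing the
    -- window `[M, M + w)` has an element past it and, by the gap condition, none before it. Such
    -- members are left to the recursion.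
    obtain ⟨M, ⟨A, hA, hAM⟩, hmin⟩ : ∃ M, (∃ A ∈ T, ∀ x ∈ A, x ≤ M) ∧
        ∀ B ∈ T, ∃ x ∈ B, M ≤ x := by
      refine ⟨Nat.find hex, Nat.find_spec hex, fun B hB => ?_⟩
      by_contra hcon
      push Not at hcon
      obtain ⟨b, hb⟩ := hne B hB
      have := hcon b hb
      refine Nat.find_min hex (m := Nat.find hex - 1) (by omega) ⟨B, hB, fun x hx => ?_⟩
      have := hcon x hx
      omega
    obtain ⟨a, ha⟩ := hne A hA
    have h1 := hlo A hA a ha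
    have h2 := hhi A hA a ha
    have h3 := hAM a ha
    obtain ⟨L, W, hL, hLp, hW, hWT⟩ := ih (lo + n - (M + w)) (by omega) (M + w)
      {B ∈ T | ∀ x ∈ B, M + w ≤ x} (fun B hB => hne B hB.1) (fun B hB => hgap B hB.1)
      (fun B hB => hB.2) (fun B hB x hx => by
        have := hB.2 x hx
        have := hhi B hB.1 x hx
        omega)
    refine ⟨A :: L, Finset.Ico M (M + w) ∪ W, ?_, ?_, ?_, ?_⟩
    · intro B hB
      rcases List.mem_cons.1 hB with rfl | hB
      · exact hA
      · exact (hL B hB).1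
    · refine List.pairwise_cons.2 ⟨fun B hB x hx y hy => ?_, hLp⟩
      have := hAM x hx
      have := (hL B hB).2 y hy
      omega
    · refine (Finset.card_union_le _ _).trans ?_
      rw [Nat.card_Ico, List.length_cons, add_mul, one_mul]
      omega
    · intro B hB
      by_cases hBW : ∃ x ∈ B, M ≤ x ∧ x < M + w
      · obtain ⟨x, hx, hx'⟩ := hBW
        exact ⟨x, hx, by simp [hx']⟩
      · obtain ⟨b, hb, hMb⟩ := hmin B hB
        have hb' : M + w ≤ b := by
          by_contra h
          exact hBW ⟨b, hb, hMb, by omega⟩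
        obtain ⟨x, hx, hxW⟩ := hWT B ⟨hB, fun x hx => by
          by_contra hlt
          rcases Nat.lt_or_ge x M with h | h
          · exact hBW (hgap B hB x hx b hb M h hb')
          · exact hBW ⟨x, hx, h, by omega⟩⟩
        exact ⟨x, hx, by simp [hxW]⟩

/-! ### Crossing paths and potentials -/

/-- A walk from inside to outside of `Low` contains a subpath which starts in `S ∩ Low`, ends in
`S \ Low` and has no other vertex in `S`. -/
lemma exists_crossing {G : SimpleGraph V} (S Low : Set V) {x y : V} (p : G.Walk x y)
    (hx : x ∈ S) (hx' : x ∈ Low) (hy : y ∈ S) (hy' : y ∉ Low) :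
    ∃ (a b : V) (q : G.Walk a b), q.IsPath ∧ (∀ z ∈ q.support, z ∈ p.support) ∧ a ∈ S ∧ a ∈ Low ∧
      b ∈ S ∧ b ∉ Low ∧ ∀ z ∈ q.support, z ∈ S → z = a ∨ z = b := by
  -- A shortest path of this kind works: an inner vertex in `S` could replace one of the ends,
  -- depending on which side of `Low` it lies.
  have hex : ∃ n, ∃ (a b : V) (q : G.Walk a b), q.IsPath ∧ (∀ z ∈ q.support, z ∈ p.support) ∧
      a ∈ S ∧ a ∈ Low ∧ b ∈ S ∧ b ∉ Low ∧ q.length = n :=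
    ⟨_, x, y, p.bypass, p.bypass_isPath, fun z hz => p.support_bypass_subset_support hz, hx, hx', hy, hy',
      rfl⟩
  obtain ⟨a, b, q, hq, hqp, ha, ha', hb, hb', hlen⟩ := Nat.find_spec hex
  refine ⟨a, b, q, hq, hqp, ha, ha', hb, hb', fun z hz hzS => ?_⟩
  by_contra hcon
  push Not at hcon
  have hspec := congrArg SimpleGraph.Walk.length (q.take_spec hz)
  rw [SimpleGraph.Walk.length_append] at hspec
  have h1 : 0 < (q.takeUntil z hz).length := by
    rw [Nat.pos_iff_ne_zero]
    intro h
    exact hcon.1 (SimpleGraph.Walk.eq_of_length_eq_zero h).symm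
  have h2 : 0 < (q.dropUntil z hz).length := by
    rw [Nat.pos_iff_ne_zero]
    intro h
    exact hcon.2 (SimpleGraph.Walk.eq_of_length_eq_zero h)
  by_cases hzL : z ∈ Low
  · refine Nat.find_min hex (m := (q.dropUntil z hz).length) (by omega)
      ⟨z, b, q.dropUntil z hz, hq.dropUntil hz, fun t ht => hqp t ?_, hzS, hzL, hb, hb', rfl⟩
    exact q.support_dropUntil_subset_support hz ht
  · refine Nat.find_min hex (m := (q.takeUntil z hz).length) (by omega)
      ⟨a, z, q.takeUntil z hz, hq.takeUntil hz, fun t ht => hqp t ?_, ha, ha', hzS, hzL, rfl⟩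
    exact q.support_takeUntil_subset_support hz ht

section Potential

variable {A : SimpleGraph V} {h : V → ℕ} {a b : V} {L : ℕ}

lemma potential_le_of_notMem_edges (hLip : ∀ x y, A.Adj x y → s(x, y) ≠ s(a, b) → h x ≤ h y + 1)
    {x y : V} (p : A.Walk x y) (hp : s(a, b) ∉ p.edges) :
    h x ≤ h y + p.length ∧ h y ≤ h x + p.length := by
  induction p with
  | nil => simp
  | @cons u v w hadj p ih =>
    simp only [SimpleGraph.Walk.edges_cons, List.mem_cons, not_or] at hp
    have h1 := ih hp.2
    have h2 := hLip u v hadj (Ne.symm hp.1)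
    have h3 := hLip v u hadj.symm (by rw [Sym2.eq_swap]; exact Ne.symm hp.1)
    rw [SimpleGraph.Walk.length_cons]
    omega

/-- A trail uses the edge `ab` only once, so the jump of at least `L` must be made up by the other
edges or appear in the difference between the ends. -/
lemma potential_le_of_mem_edges (hLip : ∀ x y, A.Adj x y → s(x, y) ≠ s(a, b) → h x ≤ h y + 1)
    (hab : h a + L ≤ h b) {x y : V} (p : A.Walk x y) (ht : p.IsTrail) (hp : s(a, b) ∈ p.edges) :
    L + h x + 1 ≤ h y + p.length ∨ L + h y + 1 ≤ h x + p.length := by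
  induction p with
  | nil => simp at hp
  | @cons u v w hadj p ih =>
    rw [SimpleGraph.Walk.isTrail_cons] at ht
    rw [SimpleGraph.Walk.length_cons]
    by_cases he : s(u, v) = s(a, b)
    · have h1 := potential_le_of_notMem_edges hLip p (he ▸ ht.2)
      rcases Sym2.eq_iff.1 he with ⟨rfl, rfl⟩ | ⟨rfl, rfl⟩ <;> omega
    · have hp' : s(a, b) ∈ p.edges := by
        simpa [SimpleGraph.Walk.edges_cons, Ne.symm he] using hp
      have h1 := ih ht.1 hp'
      have h2 := hLip u v hadj he
      have h3 := hLip v u hadj.symm (by rwa [Sym2.eq_swap])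
      omega

/-- A cycle through an edge across which a potential jumps by `L` is long, if the potential
changes by at most one along every other edge. -/
lemma lt_length_of_potential (hLip : ∀ x y, A.Adj x y → s(x, y) ≠ s(a, b) → h x ≤ h y + 1)
    (hab : h a + L ≤ h b) {x : V} (c : A.Walk x x) (hc : c.IsCycle) (he : s(a, b) ∈ c.edges) :
    L < c.length := by
  have := potential_le_of_mem_edges hLip hab c hc.isTrail he
  omega

end Potential

/-! ### Good subgraphs and their extensions -/

/-- A subgraph `K` of `G` with finite vertex set `S`, all of whose degrees are two or three and
all of whose cycles have length at least `ℓ`. -/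
structure IsGood (G K : SimpleGraph V) (ℓ : ℕ) (S : Finset V) : Prop where
  le : K ≤ G
  mem : ∀ x y, K.Adj x y → x ∈ S
  deg : ∀ v ∈ S, degIn K S v = 2 ∨ degIn K S v = 3
  long : ∀ (v : V) (c : K.Walk v v), c.IsCycle → ℓ ≤ c.length

lemma isGood_bot (G : SimpleGraph V) (ℓ : ℕ) : IsGood G ⊥ ℓ ∅ where
  le := bot_le
  mem := by simp
  deg := by simp
  long := fun _ _ hc => (hc.ne_bot rfl).elim

lemma degIn_eq_ncard {K : SimpleGraph V} {S : Finset V} {v : V} (h : ∀ w, K.Adj v w → w ∈ S) :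
    degIn K S v = (K.neighborSet v).ncard := by
  have : K.neighborSet v = (S.filter (K.Adj v) : Finset V) := by
    ext w
    simp only [SimpleGraph.mem_neighborSet, Finset.coe_filter, Set.mem_ofPred_eq]
    exact ⟨fun hw => ⟨h w hw, hw⟩, fun hw => hw.2⟩
  rw [this, Set.ncard_coe_finset, ← degIn_eq_card]

lemma IsGood.mem_right {G K : SimpleGraph V} {ℓ : ℕ} {S : Finset V} (h : IsGood G K ℓ S) {x y : V}
    (hxy : K.Adj x y) : y ∈ S :=
  h.mem y x hxy.symm

lemma IsGood.degIn_eq {G K : SimpleGraph V} {ℓ : ℕ} {S : Finset V} (h : IsGood G K ℓ S) (v : V) :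
    degIn K S v = (K.neighborSet v).ncard :=
  degIn_eq_ncard fun _ hw => h.mem_right hw

/-- The graph obtained from `K` by adding the edges of a walk. -/
def addWalk (K : SimpleGraph V) {G : SimpleGraph V} {x y : V} (q : G.Walk x y) : SimpleGraph V :=
  K ⊔ q.toSubgraph.spanningCoe

section AddWalk

variable {G K : SimpleGraph V} {ℓ : ℕ} {S : Finset V} {x y : V} {q : G.Walk x y}

lemma le_addWalk : K ≤ addWalk K q := le_sup_left

lemma addWalk_le (h : K ≤ G) : addWalk K q ≤ G :=
  sup_le h q.toSubgraph.spanningCoe_le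

lemma addWalk_mem (h : IsGood G K ℓ S) (a b : V) (hab : (addWalk K q).Adj a b) :
    a ∈ S ∪ q.support.toFinset := by
  rcases hab with hab | hab
  · exact Finset.mem_union_left _ (h.mem a b hab)
  · exact Finset.mem_union_right _ (by simpa using q.mem_support_of_adj_toSubgraph hab)

lemma addWalk_degIn (h : IsGood G K ℓ S) (v : V) :
    degIn (addWalk K q) (S ∪ q.support.toFinset) v =
      (K.neighborSet v ∪ q.toSubgraph.neighborSet v).ncard :=
  degIn_eq_ncard fun w hw => addWalk_mem h w v hw.symm

/-- Cycles using no new edge already lie in `K`, so it suffices to treat cycles through one given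
edge of the walk. -/
lemma addWalk_long (h : IsGood G K ℓ S)
    (hnew : ∀ i < q.length, ∀ (v : V) (c : (addWalk K q).Walk v v), c.IsCycle →
      s(q.getVert i, q.getVert (i + 1)) ∈ c.edges → ℓ ≤ c.length)
    (v : V) (c : (addWalk K q).Walk v v) (hc : c.IsCycle) : ℓ ≤ c.length := by
  by_cases hK : ∀ e ∈ c.edges, e ∈ K.edgeSet
  · have := h.long v (c.transfer K hK) (hc.transfer hK)
    rwa [SimpleGraph.Walk.length_transfer] at this
  · push Not at hK
    obtain ⟨e, he, heK⟩ := hK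
    induction e using Sym2.ind with
    | _ a b =>
      have hadj : (addWalk K q).Adj a b := c.adj_of_mem_edges he
      rcases hadj with hab | hab
      · exact absurd hab heK
      · obtain ⟨i, hi, hlt⟩ := q.toSubgraph_adj_iff.1 hab
        exact hnew i hlt v c hc (hi ▸ he)

end AddWalk

lemma mem_branch {K : SimpleGraph V} {S : Finset V} {v : V} :
    v ∈ branch K S ↔ v ∈ S ∧ degIn K S v = 3 := by
  simp [branch]

/-- A potential separating the ends of a pair at distance at least `ℓ`. -/
lemma exists_potential (K : SimpleGraph V) (ℓ : ℕ) {x y : V}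
    (hfar : ∀ p : K.Walk x y, ℓ ≤ p.length) :
    ∃ d : V → ℕ, d x = 0 ∧ d y = ℓ ∧ ∀ u v, K.Adj u v → d v ≤ d u + 1 := by
  -- The potential is the distance from `x` truncated at `ℓ`; the extra element `ℓ` also covers
  -- vertices unreachable from `x`.
  let T : V → Set ℕ := fun v => {n | ∃ p : K.Walk x v, p.length = n} ∪ {ℓ}
  have hT : ∀ v, (T v).Nonempty := fun v => ⟨ℓ, Or.inr rfl⟩
  refine ⟨fun v => sInf (T v), ?_, ?_, ?_⟩
  · exact Nat.le_zero.1 (Nat.sInf_le (Or.inl ⟨.nil, rfl⟩))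
  · refine le_antisymm (Nat.sInf_le (Or.inr rfl)) ?_
    beta_reduce
    rcases Nat.sInf_mem (hT y) with ⟨p, hp⟩ | h
    · rw [← hp]
      exact hfar p
    · exact (Set.mem_singleton_iff.1 h).ge
  · intro u v huv
    beta_reduce
    rcases Nat.sInf_mem (hT u) with ⟨p, hp⟩ | h
    · rw [← hp]
      exact Nat.sInf_le (Or.inl ⟨p.concat huv, by simp⟩)
    · rw [Set.mem_singleton_iff.1 h]
      exact (Nat.sInf_le (Or.inr rfl)).trans (Nat.le_succ ℓ)

/-- Adding an ear between two vertices of degree two at distance at least `ℓ`. -/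
lemma IsGood.add_ear {G K : SimpleGraph V} {ℓ : ℕ} {S : Finset V} (h : IsGood G K ℓ S)
    {x y : V} {q : G.Walk x y} (hq : q.IsPath) (hne : x ≠ y) (hx : x ∈ S) (hy : y ∈ S)
    (hxb : x ∉ branch K S) (hyb : y ∉ branch K S)
    (hint : ∀ z ∈ q.support, z ∈ S → z = x ∨ z = y) (hadj : ¬ K.Adj x y)
    (hfar : ∀ p : K.Walk x y, ℓ ≤ p.length) :
    IsGood G (addWalk K q) ℓ (S ∪ q.support.toFinset) ∧
      (branch K S).card < (branch (addWalk K q) (S ∪ q.support.toFinset)).card := by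
  have hnil : ¬ q.Nil := fun hn => hne hn.eq
  have hend : ∀ v, v = x ∨ v = y →
      degIn (addWalk K q) (S ∪ q.support.toFinset) v = 3 := by
    intro v hv
    have hvS : v ∈ S := by rcases hv with rfl | rfl <;> assumption
    have hvb : v ∉ branch K S := by rcases hv with rfl | rfl <;> assumption
    have h2 : degIn K S v = 2 := (h.deg v hvS).resolve_right fun h3 =>
      hvb (mem_branch.2 ⟨hvS, h3⟩)
    obtain ⟨t, ht⟩ : ∃ t, q.toSubgraph.neighborSet v = {t} := by
      rcases hv with rfl | rfl
      · exact ⟨_, hq.neighborSet_toSubgraph_startpoint hnil⟩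
      · exact ⟨_, hq.neighborSet_toSubgraph_endpoint hnil⟩
    have htadj : q.toSubgraph.Adj v t := by
      have : t ∈ q.toSubgraph.neighborSet v := by rw [ht]; rfl
      exact this
    -- A neighbour along the ear that lies in `S` is the other end of the ear, and the ends are
    -- nonadjacent in `K`; so the degree really rises to three.
    have htK : t ∉ K.neighborSet v := by
      intro hK
      have hK' : K.Adj v t := hK
      have h1 := hint t (q.mem_support_of_adj_toSubgraph htadj.symm) (h.mem_right hK')
      rcases hv with rfl | rfl <;> rcases h1 with rfl | rfl
      · exact K.loopless.irrefl _ hK'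
      · exact hadj hK'
      · exact hadj hK'.symm
      · exact K.loopless.irrefl _ hK'
    have hfin : (K.neighborSet v).Finite := by
      rw [h.degIn_eq] at h2
      exact Set.finite_of_ncard_ne_zero (by omega)
    rw [addWalk_degIn h, ht, Set.union_singleton, Set.ncard_insert_of_notMem htK hfin,
      ← h.degIn_eq, h2]
  have hother : ∀ v ∈ S, v ≠ x → v ≠ y →
      degIn (addWalk K q) (S ∪ q.support.toFinset) v = degIn K S v := by
    intro v hv hvx hvy
    have : q.toSubgraph.neighborSet v = ∅ := by
      ext t
      simp only [SimpleGraph.Subgraph.mem_neighborSet, Set.mem_empty_iff_false, iff_false]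
      intro ht
      rcases hint v (q.mem_support_of_adj_toSubgraph ht) hv with h | h
      · exact hvx h
      · exact hvy h
    rw [addWalk_degIn h, this, Set.union_empty, h.degIn_eq]
  have hnew : ∀ v ∈ q.support, v ∉ S →
      degIn (addWalk K q) (S ∪ q.support.toFinset) v = 2 := by
    intro v hv hvS
    have h1 : K.neighborSet v = ∅ := by
      ext t
      simp only [SimpleGraph.mem_neighborSet, Set.mem_empty_iff_false, iff_false]
      exact fun ht => hvS (h.mem _ _ ht)
    obtain ⟨i, rfl, hi⟩ := SimpleGraph.Walk.mem_support_iff_exists_getVert.1 hv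
    rw [addWalk_degIn h, h1, Set.empty_union]
    refine hq.ncard_neighborSet_toSubgraph_internal_eq_two ?_ ?_
    · rintro rfl
      exact hvS (by simpa using hx)
    · refine lt_of_le_of_ne hi ?_
      rintro rfl
      exact hvS (by simpa using hy)
  refine ⟨⟨addWalk_le h.le, addWalk_mem h, ?_, addWalk_long h ?_⟩, ?_⟩
  · intro v hv
    by_cases hvS : v ∈ S
    · by_cases hvx : v = x ∨ v = y
      · exact Or.inr (hend v hvx)
      · push Not at hvx
        rw [hother v hvS hvx.1 hvx.2]
        exact h.deg v hvS
    · exact Or.inl (hnew v (by simpa [hvS] using hv) hvS)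
  · intro i hi v c hc he
    obtain ⟨d, hdx, hdy, hd⟩ := exists_potential K ℓ hfar
    obtain ⟨idx, hidx⟩ : ∃ idx : V → ℕ, ∀ j ≤ q.length, idx (q.getVert j) = j :=
      ⟨Function.invFunOn q.getVert {j | j ≤ q.length},
        fun j hj => hq.getVert_injOn.leftInvOn_invFunOn hj⟩
    -- The truncated distance is extended along the ear as `0` up to index `i` and `ℓ` after it, so
    -- that the whole jump sits on the chosen edge.
    set f : V → ℕ := fun v => if v ∈ S then d v else if idx v ≤ i then 0 else ℓ with hf
    have hfj : ∀ j ≤ q.length, f (q.getVert j) = if j ≤ i then 0 else ℓ := by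
      intro j hj
      simp only [hf, hidx j hj]
      by_cases hjS : q.getVert j ∈ S
      · rw [if_pos hjS]
        rcases hint _ (q.getVert_mem_support j) hjS with h1 | h1
        · have h2 : j = 0 := (hq.getVert_eq_start_iff hj).1 h1
          rw [if_pos (by omega), h1, hdx]
        · have h2 : j = q.length := (hq.getVert_eq_end_iff hj).1 h1
          rw [if_neg (by omega), h1, hdy]
      · rw [if_neg hjS]
    refine (lt_length_of_potential (h := f) (L := ℓ) ?_ ?_ c hc he).le
    · rintro u v (huv | huv) hne
      · simp only [hf, h.mem _ _ huv, h.mem_right huv, if_true]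
        exact hd v u huv.symm
      · obtain ⟨j, hj, hlt⟩ := q.toSubgraph_adj_iff.1 huv
        have hji : j ≠ i := by
          rintro rfl
          exact hne hj.symm
        have h1 := hfj j hlt.le
        have h2 := hfj (j + 1) hlt
        rcases Sym2.eq_iff.1 hj with ⟨rfl, rfl⟩ | ⟨rfl, rfl⟩ <;>
        · rw [h1, h2]
          split_ifs <;> omega
    · rw [hfj i hi.le, hfj (i + 1) hi, if_pos le_rfl, if_neg (by omega), zero_add]
  · refine Finset.card_lt_card ⟨?_, ?_⟩
    · intro v hv
      obtain ⟨hvS, hv3⟩ := mem_branch.1 hv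
      refine mem_branch.2 ⟨Finset.mem_union_left _ hvS, ?_⟩
      rw [hother v hvS (by rintro rfl; exact hxb hv) (by rintro rfl; exact hyb hv), hv3]
    · exact fun hsub => hxb (hsub (mem_branch.2 ⟨Finset.mem_union_left _ hx, hend x (Or.inl rfl)⟩))

/-- Adding a disjoint long cycle. -/
lemma IsGood.add_cycle {G K : SimpleGraph V} {ℓ : ℕ} {S : Finset V} (h : IsGood G K ℓ S)
    {x : V} {q : G.Walk x x} (hq : q.IsCycle) (hlen : ℓ ≤ q.length)
    (hdisj : ∀ z ∈ q.support, z ∉ S) :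
    IsGood G (addWalk K q) ℓ (S ∪ q.support.toFinset) ∧
      branch (addWalk K q) (S ∪ q.support.toFinset) = branch K S ∧
      IsCarrier (addWalk K q) q.support.toFinset := by
  have hold : ∀ v ∈ S, degIn (addWalk K q) (S ∪ q.support.toFinset) v = degIn K S v := by
    intro v hv
    have : q.toSubgraph.neighborSet v = ∅ := by
      ext t
      simp only [SimpleGraph.Subgraph.mem_neighborSet, Set.mem_empty_iff_false, iff_false]
      exact fun ht => hdisj v (q.mem_support_of_adj_toSubgraph ht) hv
    rw [addWalk_degIn h, this, Set.union_empty, h.degIn_eq]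
  have hKnew : ∀ v ∈ q.support, K.neighborSet v = ∅ := by
    intro v hv
    ext t
    simp only [SimpleGraph.mem_neighborSet, Set.mem_empty_iff_false, iff_false]
    exact fun ht => hdisj v hv (h.mem _ _ ht)
  have hnew : ∀ v ∈ q.support, degIn (addWalk K q) (S ∪ q.support.toFinset) v = 2 := by
    intro v hv
    rw [addWalk_degIn h, hKnew v hv, Set.empty_union]
    exact hq.ncard_neighborSet_toSubgraph_eq_two hv
  refine ⟨⟨addWalk_le h.le, addWalk_mem h, ?_, addWalk_long h ?_⟩, ?_, ⟨x, by simp⟩, ?_⟩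
  · intro v hv
    by_cases hvS : v ∈ S
    · rw [hold v hvS]
      exact h.deg v hvS
    · exact Or.inl (hnew v (by simpa [hvS] using hv))
  · intro i hi v c hc he
    have h3 := hq.three_le_length
    obtain ⟨idx, hidx⟩ : ∃ idx : V → ℕ, ∀ j < q.length, idx (q.getVert j) = j :=
      ⟨Function.invFunOn q.getVert {j | j ≤ q.length - 1},
        fun j hj => hq.getVert_injOn'.leftInvOn_invFunOn (show j ≤ q.length - 1 by omega)⟩
    -- On the new cycle `f` counts steps from the vertex with index `i + 1` onwards, so it reaches
    -- `q.length - 1` at index `i` and drops to `0` across the chosen edge.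
    set f : V → ℕ := fun v => if v ∈ S then 0 else
      if idx v ≤ i then q.length - 1 - i + idx v else idx v - i - 1 with hf
    have hfj : ∀ j < q.length, f (q.getVert j) =
        if j ≤ i then q.length - 1 - i + j else j - i - 1 := by
      intro j hj
      simp only [hf, hidx j hj, if_neg (hdisj _ (q.getVert_mem_support j))]
    have hfN : f (q.getVert q.length) = q.length - 1 - i := by
      have := hfj 0 (by omega)
      rw [q.getVert_length]
      simpa using this
    have hfi : f (q.getVert i) = q.length - 1 := by
      rw [hfj i hi, if_pos le_rfl]
      omega
    have hfi' : f (q.getVert (i + 1)) = 0 := by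
      rcases Nat.lt_or_ge (i + 1) q.length with h1 | h1
      · rw [hfj _ h1, if_neg (by omega)]
        omega
      · have e : i + 1 = q.length := by omega
        rw [e, hfN]
        omega
    have key := lt_length_of_potential (h := f) (L := q.length - 1)
      (a := q.getVert (i + 1)) (b := q.getVert i) ?_ (by omega) c hc (by rwa [Sym2.eq_swap])
    · omega
    · rintro u v (huv | huv) hne
      · simp [hf, h.mem _ _ huv]
      · obtain ⟨j, hj, hlt⟩ := q.toSubgraph_adj_iff.1 huv
        have hji : j ≠ i := by
          rintro rfl
          exact hne (by rw [← hj, Sym2.eq_swap])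
        have h1 := hfj j hlt
        have h2 : f (q.getVert (j + 1)) ≤ f (q.getVert j) + 1 ∧
            f (q.getVert j) ≤ f (q.getVert (j + 1)) + 1 := by
          rcases Nat.lt_or_ge (j + 1) q.length with h2 | h2
          · rw [h1, hfj _ h2]
            split_ifs <;> omega
          · have e : j + 1 = q.length := by omega
            rw [h1, e, hfN]
            split_ifs <;> omega
        rcases Sym2.eq_iff.1 hj with ⟨rfl, rfl⟩ | ⟨rfl, rfl⟩
        · exact h2.2
        · exact h2.1
  · ext v
    rw [mem_branch, mem_branch]
    constructor
    · rintro ⟨hv, hv3⟩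
      by_cases hvS : v ∈ S
      · exact ⟨hvS, hold v hvS ▸ hv3⟩
      · have := hnew v (by simpa [hvS] using hv)
        omega
    · rintro ⟨hv, hv3⟩
      exact ⟨Finset.mem_union_left _ hv, (hold v hv).trans hv3⟩
  · intro v hv
    rw [List.mem_toFinset] at hv
    have : degIn (addWalk K q) q.support.toFinset v =
        ((addWalk K q).neighborSet v).ncard := by
      refine degIn_eq_ncard fun w hw => ?_
      rcases hw with hw | hw
      · exact absurd (h.mem _ _ hw) (hdisj v hv)
      · simpa using q.mem_support_of_adj_toSubgraph hw.symm
    rw [this, ← degIn_eq_ncard (fun w hw => addWalk_mem h w v hw.symm), hnew v hv]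

lemma HasCarriers.of_le {K : SimpleGraph V} {S : Finset V} {m k : ℕ} (h : HasCarriers K S m)
    (hkm : k ≤ m) : HasCarriers K S k := by
  obtain ⟨L, h1, h2, h3⟩ := h
  exact ⟨L.take k, by simp [h1, hkm], h2.sublist (L.take_sublist k),
    fun C hC => h3 C (List.mem_of_mem_take hC)⟩

lemma IsGood.hasDisjointLongCycles {G K : SimpleGraph V} {ℓ k : ℕ} {S T : Finset V}
    (h : IsGood G K ℓ S) (hk : HasCarriers K T k) : HasDisjointLongCycles G k ℓ := by
  obtain ⟨L, rfl, hd, hL⟩ := hk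
  have hc : ∀ i : Fin L.length, ∃ (v : V) (c : K.Walk v v), c.IsCycle ∧
      ∀ z ∈ c.support, z ∈ L.get i := fun i => exists_isCycle_of_isCarrier (hL _ (L.get_mem i)).2
  choose v c hc hsup using hc
  refine ⟨v, fun i => (c i).mapLe h.le, fun i => ⟨(hc i).mapLe h.le, ?_⟩, ?_⟩
  · simpa using h.long _ _ (hc i)
  · intro i j hij x hx hx'
    rw [SimpleGraph.Walk.support_mapLe_eq_support] at hx hx'
    have hdis : Disjoint (L.get i) (L.get j) := by
      rw [List.pairwise_iff_get] at hd
      rcases lt_or_gt_of_ne hij with hlt | hlt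
      · exact hd i j hlt
      · exact (hd j i hlt).symm
    exact Finset.disjoint_left.1 hdis (hsup i x hx) (hsup j x hx')

/-! ### The extremal subgraph -/

/-- An extremal good subgraph. -/
theorem exists_extremal (G : SimpleGraph V) (k ℓ : ℕ) (hno : ¬ HasDisjointLongCycles G k ℓ) :
    ∃ (K : SimpleGraph V) (S : Finset V), IsGood G K ℓ S ∧ ((branch K S).card : ℝ) < sSeq k ∧
      (∀ m, HasCarriers K S m → m < k) ∧
      (∀ (x y : V) (q : G.Walk x y), q.IsPath → x ≠ y → x ∈ S → y ∈ S → x ∉ branch K S →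
        y ∉ branch K S → (∀ z ∈ q.support, z ∈ S → z = x ∨ z = y) → ¬ K.Adj x y →
        ∃ p : K.Walk x y, p.length < ℓ) ∧
      ∀ (v : V) (c : G.Walk v v), c.IsCycle → ℓ ≤ c.length → ∃ z ∈ c.support, z ∈ S := by
  have hm : ∀ (K : SimpleGraph V) (S : Finset V), IsGood G K ℓ S → ∀ m, HasCarriers K S m →
      m < k := by
    intro K S h m hm
    by_contra hcon
    exact hno (h.hasDisjointLongCycles (hm.of_le (not_lt.1 hcon)))
  have hb : ∀ (K : SimpleGraph V) (S : Finset V), IsGood G K ℓ S →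
      ((branch K S).card : ℝ) < sSeq k := by
    intro K S h
    by_contra hcon
    exact hno (h.hasDisjointLongCycles (hasCarriers_of_sSeq_le K k S h.deg (not_lt.1 hcon)))
  -- Since `m < k`, this value orders pairs lexicographically, branch vertices first. It is bounded
  -- because `|U| < sSeq k`.
  let vals : Set ℕ := {N | ∃ (K : SimpleGraph V) (S : Finset V) (m : ℕ), IsGood G K ℓ S ∧
    HasCarriers K (S \ branch K S) m ∧ N = (branch K S).card * k + m}
  have hne : vals.Nonempty :=
    ⟨_, ⊥, ∅, 0, isGood_bot G ℓ, hasCarriers_zero _ _, rfl⟩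
  have hbdd : BddAbove vals := by
    refine ⟨⌈sSeq k⌉₊ * k + k, ?_⟩
    rintro N ⟨K, S, m, hK, hc, rfl⟩
    have h1 := hm K S hK m (hc.mono Finset.sdiff_subset)
    have h2 : (branch K S).card ≤ ⌈sSeq k⌉₊ := by
      exact_mod_cast (hb K S hK).le.trans (Nat.le_ceil _)
    have := Nat.mul_le_mul_right k h2
    omega
  obtain ⟨K, S, m, hK, hc, hval⟩ := Nat.sSup_mem hne hbdd
  have hmk := hm K S hK m (hc.mono Finset.sdiff_subset)
  have hmax : ∀ (K' : SimpleGraph V) (S' : Finset V) (m' : ℕ), IsGood G K' ℓ S' →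
      HasCarriers K' (S' \ branch K' S') m' →
      (branch K' S').card * k + m' ≤ (branch K S).card * k + m := by
    intro K' S' m' h1 h2
    rw [← hval]
    exact le_csSup hbdd ⟨K', S', m', h1, h2, rfl⟩
  refine ⟨K, S, hK, hb K S hK, hm K S hK, ?_, ?_⟩
  · intro x y q hq hne hx hy hxb hyb hint hadj
    by_contra hcon
    push Not at hcon
    obtain ⟨h1, h2⟩ := hK.add_ear hq hne hx hy hxb hyb hint hadj hcon
    -- The ear may destroy every counted carrier, but one more branch vertex is worth `k > m`.
    have h3 := hmax _ _ 0 h1 (hasCarriers_zero _ _)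
    have h4 := Nat.mul_le_mul_right k (Nat.succ_le_of_lt h2)
    rw [Nat.succ_mul] at h4
    omega
  · intro v c hcyc hlen
    by_contra hcon
    push Not at hcon
    obtain ⟨h1, h2, h3⟩ := hK.add_cycle hcyc hlen hcon
    have h4 := hmax _ _ (m + 1) h1 (by
      rw [h2]
      refine (hc.mono_graph le_addWalk).cons ?_ h3 ?_ ?_
      · exact Finset.sdiff_subset_sdiff Finset.subset_union_left subset_rfl
      · intro z hz
        refine Finset.mem_sdiff.2 ⟨Finset.mem_union_right _ hz, fun hzb => ?_⟩
        exact hcon z (by simpa using hz) (branch_subset K S hzb)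
      · rw [Finset.disjoint_left]
        exact fun z hz hz' => hcon z (by simpa using hz') (Finset.mem_sdiff.1 hz).1)
    rw [h2] at h4
    omega

/-! ### Balls around the branch vertices -/

/-- Past the branch set all degrees are two and one neighbour is the parent, so spheres do not grow
after the first, which has at most three vertices per branch vertex. -/
lemma card_sphere_branch_le (K : SimpleGraph V) {S : Finset V}
    (h : ∀ v ∈ S, degIn K S v = 2 ∨ degIn K S v = 3) (i : ℕ) :
    (sphere K S (branch K S) (i + 1)).card ≤ 3 * (branch K S).card := by
  have hb := branch_subset K S
  induction i with
  | zero =>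
    have hsub : sphere K S (branch K S) 1 ⊆ (branch K S).biUnion (fun x => S.filter (K.Adj x)) := by
      intro w hw
      obtain ⟨x, hx, hwx⟩ := exists_parent K hw
      exact Finset.mem_biUnion.2 ⟨x, hx, Finset.mem_filter.2
        ⟨ball_subset K hb _ (sphere_subset_ball _ _ _ _ hw), hwx.symm⟩⟩
    refine (Finset.card_le_card hsub).trans ?_
    rw [mul_comm]
    refine Finset.card_biUnion_le_card_mul _ _ _ fun x hx => ?_
    have := (mem_branch.1 hx).2
    rw [degIn_eq_card] at this
    exact this.le
  | succ i ih =>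
    refine le_trans ?_ ih
    have key := Finset.card_mul_le_card_mul (s := sphere K S (branch K S) (i + 2))
      (t := sphere K S (branch K S) (i + 1)) K.Adj (m := 1) (n := 1) ?_ ?_
    · simpa using key
    · intro w hw
      obtain ⟨x, hx, hwx⟩ := exists_parent K hw
      exact Finset.card_pos.2 ⟨x, (Finset.mem_bipartiteAbove _).2 ⟨hx, hwx⟩⟩
    · intro x hx
      have hxS := ball_subset K hb _ (sphere_subset_ball _ _ _ _ hx)
      have hx2 : degIn K S x = 2 := (h x hxS).resolve_right fun h3 =>
        sphere_disjoint_ball K S _ (Nat.succ_pos i) hx (mem_branch.2 ⟨hxS, h3⟩)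
      obtain ⟨y, hy, hxy⟩ := exists_parent K hx
      have hyS := ball_subset K hb _ (sphere_subset_ball _ _ _ _ hy)
      rw [Finset.card_le_one]
      intro a ha b hb'
      rw [Finset.mem_bipartiteBelow] at ha hb'
      have hyb : ∀ c ∈ sphere K S (branch K S) (i + 2), c ≠ y := by
        rintro c hc rfl
        exact sphere_disjoint_ball K S _ (by omega) hc (sphere_subset_ball _ _ _ _ hy)
      by_contra hab
      have := eq_or_eq_of_degIn_le_two hx2.le
        (ball_subset K hb _ (sphere_subset_ball _ _ _ _ ha.1))
        (ball_subset K hb _ (sphere_subset_ball _ _ _ _ hb'.1)) hyS hab ha.2.symm hb'.2.symm hxy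
      rcases this with h1 | h1
      · exact hyb a ha.1 h1.symm
      · exact hyb b hb'.1 h1.symm

lemma card_ball_branch_le (K : SimpleGraph V) {S : Finset V}
    (h : ∀ v ∈ S, degIn K S v = 2 ∨ degIn K S v = 3) (i : ℕ) :
    (ball K S (branch K S) i).card ≤ (1 + 3 * i) * (branch K S).card := by
  induction i with
  | zero => simp [ball]
  | succ i ih =>
    have h1 : ball K S (branch K S) (i + 1) =
        ball K S (branch K S) i ∪ sphere K S (branch K S) (i + 1) :=
      (Finset.union_sdiff_of_subset (ball_subset_succ K S _ i)).symm
    rw [h1]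
    refine (Finset.card_union_le _ _).trans ?_
    have h2 := card_sphere_branch_le K h i
    linarith

lemma mem_ball_of_walk {K : SimpleGraph V} {S A : Finset V} (hS : ∀ x y, K.Adj x y → x ∈ S)
    {u x : V} (p : K.Walk u x) (j : ℕ) (hu : u ∈ ball K S A j) :
    x ∈ ball K S A (j + p.length) := by
  induction p generalizing j with
  | nil => exact hu
  | cons hadj p ih =>
    have := ih (j + 1) (mem_ball_succ_of_adj K hu (hS _ _ hadj.symm) hadj)
    rwa [SimpleGraph.Walk.length_cons, Nat.add_comm p.length, ← Nat.add_assoc]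

lemma exists_walk_support_subset {G : SimpleGraph V} {v x y : V} (c : G.Walk v v)
    (hx : x ∈ c.support) (hy : y ∈ c.support) :
    ∃ p : G.Walk x y, ∀ z ∈ p.support, z ∈ c.support := by
  refine ⟨(c.dropUntil x hx).append (c.takeUntil y hy), fun z hz => ?_⟩
  rcases (SimpleGraph.Walk.mem_support_append_iff _ _).1 hz with h | h
  · exact c.support_dropUntil_subset_support hx h
  · exact c.support_takeUntil_subset_support hy h

lemma IsGood.support_subset {G K : SimpleGraph V} {ℓ : ℕ} {S : Finset V} (h : IsGood G K ℓ S)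
    {x y : V} (p : K.Walk x y) (hx : x ∈ S) : ∀ z ∈ p.support, z ∈ S := by
  induction p with
  | nil => simpa using hx
  | cons hadj p ih =>
    intro z hz
    rw [SimpleGraph.Walk.support_cons, List.mem_cons] at hz
    rcases hz with rfl | hz
    · exact hx
    · exact ih (h.mem_right hadj) z hz

/-! ### The hitting set -/

/-- A graph without `k` disjoint long cycles has a small set meeting all long cycles. -/
theorem exists_hitting_set (G : SimpleGraph V) (k ℓ : ℕ) (hno : ¬ HasDisjointLongCycles G k ℓ) :
    ∃ X : Finset V, (X.card : ℝ) ≤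
      (2 * (ℓ : ℝ) + 4) * ((k : ℝ) - 1) + (3 * (ℓ : ℝ) / 2 + 1) * sSeq k ∧
      MeetsLongCycles G ℓ X := by
  obtain ⟨K, S, hK, hU, hcar, hear, hmeet⟩ := exists_extremal G k ℓ hno
  set U := branch K S with hUdef
  set Z := S \ U with hZ
  have hZS : Z ⊆ S := Finset.sdiff_subset
  have hZdeg : ∀ v ∈ Z, degIn K Z v ≤ 2 := by
    intro v hv
    rw [hZ, Finset.mem_sdiff] at hv
    refine (degIn_mono K hZS v).trans ?_
    rcases hK.deg v hv.1 with h | h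
    · exact h.le
    · exact absurd (mem_branch.2 ⟨hv.1, h⟩) hv.2
  obtain ⟨m, Y, pos, hm, hY, hpos, hwalk⟩ := exists_arrangement K (ℓ + 2) Z hZdeg
  have hmk : m < k := hcar m (hm.mono hZS)
  -- A path of length at most `ℓ - 1` through a vertex of `U` has an end within distance `r` of `U`,
  -- hence in `B`.
  set r := (ℓ - 1) / 2 with hr
  set B := ball K S U r with hB
  have hUB : U ⊆ B := ball_mono K S U (Nat.zero_le r)
  have hear' : ∀ (x y : V) (q : G.Walk x y), q.IsPath → x ≠ y → x ∈ S → y ∈ S →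
      x ∉ B ∪ Y → y ∉ B ∪ Y → (∀ z ∈ q.support, z ∈ S → z = x ∨ z = y) →
      pos x ≤ pos y + (ℓ + 1) := by
    intro x y q hq hne hx hy hxB hyB hint
    simp only [Finset.mem_union, not_or] at hxB hyB
    by_cases hadj : K.Adj x y
    · have h1 := hwalk x y hadj.toWalk (by
        intro z hz
        simp only [SimpleGraph.Walk.support_cons, SimpleGraph.Walk.support_nil, List.mem_cons,
          List.not_mem_nil, or_false] at hz
        rcases hz with rfl | rfl
        · exact Finset.mem_sdiff.2 ⟨hx, fun h => hxB.1 (hUB h)⟩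
        · exact Finset.mem_sdiff.2 ⟨hy, fun h => hyB.1 (hUB h)⟩) hxB.2 hyB.2 (by simp)
      simp only [SimpleGraph.Walk.length_cons, SimpleGraph.Walk.length_nil] at h1
      omega
    · obtain ⟨p, hp⟩ := hear x y q hq hne hx hy (fun h => hxB.1 (hUB h))
        (fun h => hyB.1 (hUB h)) hint hadj
      have hpZ : ∀ z ∈ p.support, z ∈ Z := by
        intro z hz
        refine Finset.mem_sdiff.2 ⟨hK.support_subset p hx z hz, fun hzU => ?_⟩
        have hspec := congrArg SimpleGraph.Walk.length (p.take_spec hz)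
        rw [SimpleGraph.Walk.length_append] at hspec
        have h1 := mem_ball_of_walk hK.mem (p.takeUntil z hz).reverse 0 (A := U) hzU
        have h2 := mem_ball_of_walk hK.mem (p.dropUntil z hz) 0 (A := U) hzU
        rw [SimpleGraph.Walk.length_reverse] at h1
        by_cases h3 : (p.takeUntil z hz).length ≤ r
        · exact hxB.1 (ball_mono K S U (by omega) h1)
        · exact hyB.1 (ball_mono K S U (by omega) h2)
      have := hwalk x y p hpZ hxB.2 hyB.2 (by omega)
      omega
  let T : Set (Set ℕ) := {A | ∃ (v : V) (c : G.Walk v v), c.IsCycle ∧ ℓ ≤ c.length ∧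
    (∀ z ∈ c.support, z ∉ B ∪ Y) ∧ A = pos '' {z | z ∈ S ∧ z ∈ c.support}}
  have hTne : ∀ A ∈ T, A.Nonempty := by
    rintro A ⟨v, c, hc, hlen, -, rfl⟩
    obtain ⟨z, hz, hzS⟩ := hmeet v c hc hlen
    exact ⟨pos z, z, ⟨hzS, hz⟩, rfl⟩
  have hTgap : ∀ A ∈ T, ∀ a ∈ A, ∀ b ∈ A, ∀ s, a < s → s + (ℓ + 2) ≤ b →
      ∃ x ∈ A, s ≤ x ∧ x < s + (ℓ + 2) := by
    rintro A ⟨v, c, hc, hlen, hav, rfl⟩ - ⟨x, ⟨hxS, hx⟩, rfl⟩ - ⟨y, ⟨hyS, hy⟩, rfl⟩ s hxs hsy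
    by_contra hcon
    push Not at hcon
    obtain ⟨p, hp⟩ := exists_walk_support_subset c hx hy
    -- A gap in the trace would be jumped by a subpath of the cycle meeting `S` only in its ends,
    -- whose positions differ by at most `ℓ + 1`.
    obtain ⟨a, b, q, hq, hqp, haS, ha, hbS, hb, hint⟩ :=
      exists_crossing (S : Set V) {z | pos z < s} p hxS hxs hyS
        (show ¬ pos y < s by omega)
    have hac := hp a (hqp a q.start_mem_support)
    have hbc := hp b (hqp b q.end_mem_support)
    simp only [Set.mem_ofPred_eq] at ha hb
    have h1 := hcon (pos b) ⟨b, ⟨hbS, hbc⟩, rfl⟩ (by omega)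
    have h2 := hear' b a q.reverse hq.reverse (by rintro rfl; exact hb ha) hbS haS (hav b hbc)
      (hav a hac) (fun z hz hzS => (hint z (by simpa using hz) hzS).symm)
    omega
  have hTlt : ∀ A ∈ T, ∀ x ∈ A, x < 0 + (S.sup pos + 1) := by
    rintro A ⟨v, c, -, -, -, rfl⟩ - ⟨x, ⟨hxS, -⟩, rfl⟩
    have := Finset.le_sup (f := pos) hxS
    omega
  obtain ⟨L, W, hL, hLsep, hW, hWT⟩ := exists_separated_and_hitting (w := ℓ + 2) (by omega)
    (S.sup pos + 1) 0 T hTne hTgap (fun _ _ _ _ => Nat.zero_le _) hTlt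
  have hLk : L.length < k := by
    by_contra hcon
    push Not at hcon
    apply hno
    have hT : ∀ i : Fin k, L.get (i.castLE hcon) ∈ T := fun i => hL _ (L.get_mem _)
    choose v c hc hlen hav hA using hT
    have hsep : ∀ i j : Fin k, i ≠ j → ∀ x ∈ S, x ∈ (c i).support → ∀ y ∈ S,
        y ∈ (c j).support → pos x + (ℓ + 2) ≤ pos y ∨ pos y + (ℓ + 2) ≤ pos x := by
      intro i j hij x hxS hx y hyS hy
      have hxA : pos x ∈ L.get (i.castLE hcon) := by rw [hA]; exact ⟨x, ⟨hxS, hx⟩, rfl⟩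
      have hyA : pos y ∈ L.get (j.castLE hcon) := by rw [hA]; exact ⟨y, ⟨hyS, hy⟩, rfl⟩
      rw [List.pairwise_iff_get] at hLsep
      rcases lt_or_gt_of_ne hij with hlt | hlt
      · exact Or.inl (hLsep _ _ (by simpa using hlt) _ hxA _ hyA)
      · exact Or.inr (hLsep _ _ (by simpa using hlt) _ hyA _ hxA)
    refine ⟨v, c, fun i => ⟨hc i, hlen i⟩, ?_⟩
    intro i j hij z hzi hzj
    obtain ⟨x, hx, hxS⟩ := hmeet _ _ (hc i) (hlen i)
    obtain ⟨y, hy, hyS⟩ := hmeet _ _ (hc j) (hlen j)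
    obtain ⟨p, hp⟩ := exists_walk_support_subset (c i) hx hzi
    obtain ⟨p', hp'⟩ := exists_walk_support_subset (c j) hzj hy
    -- If cycles `i` and `j` met in `z`, a walk from `x` along one through `z` to `y` along the
    -- other would contain a path joining their traces with no inner vertex in `S`. Its ends are at
    -- most `ℓ + 1` apart in position, against the separation `ℓ + 2`.
    obtain ⟨a, b, q, hq, hqp, haS, ha, hbS, hb, hint⟩ :=
      exists_crossing (S : Set V) {t | t ∈ (c i).support} (p.append p') hxS hx hyS (by
        intro hyi
        have := hsep i j hij y hyS hyi y hyS hy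
        omega)
    simp only [Set.mem_ofPred_eq] at ha hb
    have hbc : b ∈ (c j).support := by
      rcases (SimpleGraph.Walk.mem_support_append_iff _ _).1 (hqp b q.end_mem_support) with h | h
      · exact absurd (hp b h) hb
      · exact hp' b h
    have hne : a ≠ b := by rintro rfl; exact hb ha
    have h1 := hear' a b q hq hne haS hbS (hav i a ha) (hav j b hbc) hint
    have h2 := hear' b a q.reverse hq.reverse hne.symm hbS haS (hav j b hbc) (hav i a ha)
      (fun t ht htS => (hint t (by simpa using ht) htS).symm)
    have h3 := hsep i j hij a haS ha b hbS hbc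
    omega
  -- The cuts and the windows number at most `k - 1` each and cost `ℓ + 2` apiece, giving the term
  -- `(2ℓ + 4)(k - 1)`. The ball gives the other term, as `3r ≤ 3ℓ / 2`.
  refine ⟨B ∪ Y ∪ Z.filter (fun z => pos z ∈ W), ?_, ?_⟩
  · have h1 : (Z.filter (fun z => pos z ∈ W)).card ≤ W.card :=
      Finset.card_le_card_of_injOn pos (fun z hz => (Finset.mem_filter.1 hz).2)
        (hpos.mono fun z hz => (Finset.mem_filter.1 hz).1)
    have h2 : B.card ≤ (1 + 3 * r) * U.card := card_ball_branch_le K hK.deg r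
    have h3 : (B ∪ Y ∪ Z.filter (fun z => pos z ∈ W)).card ≤
        (1 + 3 * r) * U.card + m * (ℓ + 2) + L.length * (ℓ + 2) := by
      refine (Finset.card_union_le _ _).trans ?_
      have := Finset.card_union_le B Y
      omega
    have h4 : ((B ∪ Y ∪ Z.filter (fun z => pos z ∈ W)).card : ℝ) ≤
        (1 + 3 * (r : ℝ)) * U.card + m * ((ℓ : ℝ) + 2) + L.length * ((ℓ : ℝ) + 2) := by
      exact_mod_cast h3
    have h5 : 2 * (r : ℝ) ≤ ℓ := by exact_mod_cast (by omega : 2 * r ≤ ℓ)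
    have h6 : (m : ℝ) + 1 ≤ k := by exact_mod_cast hmk
    have h7 : (L.length : ℝ) + 1 ≤ k := by exact_mod_cast hLk
    have h8 : (0 : ℝ) ≤ ℓ := by positivity
    have h9 : (1 + 3 * (r : ℝ)) * U.card ≤ (3 * (ℓ : ℝ) / 2 + 1) * sSeq k :=
      mul_le_mul (by linarith) hU.le (by positivity) (by positivity)
    nlinarith
  · intro v c hc hlen
    by_contra hcon
    push Not at hcon
    have hav : ∀ z ∈ c.support, z ∉ B ∪ Y := fun z hz hzB =>
      hcon z (Finset.mem_union_left _ hzB) hz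
    obtain ⟨-, ⟨z, ⟨hzS, hz⟩, rfl⟩, hzW⟩ := hWT _ ⟨v, c, hc, hlen, hav, rfl⟩
    refine hcon z (Finset.mem_union_right _ (Finset.mem_filter.2 ⟨Finset.mem_sdiff.2
      ⟨hzS, fun hzU => ?_⟩, hzW⟩)) hz
    exact hav z hz (Finset.mem_union_left _ (hUB hzU))

/-! ### Asymptotics of the bound -/

lemma sSeq_nonneg (k : ℕ) : 0 ≤ sSeq k := by
  by_cases hk : 2 ≤ k
  · exact (by positivity : (0 : ℝ) ≤ 20 * (k : ℝ)).trans (sSeq_lower hk)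
  · rw [sSeq, if_neg hk]
    norm_num

lemma le_sSeq {k : ℕ} (hk : 2 ≤ k) : 4 * ((k : ℝ) * Real.logb 2 k) ≤ sSeq k := by
  rw [sSeq_of_two_le hk]
  have := logb_logb_nonneg hk
  have : (0 : ℝ) ≤ k := by positivity
  nlinarith

lemma sSeq_le {k : ℕ} (hk : 2 ≤ k) : sSeq k ≤ 24 * ((k : ℝ) * Real.logb 2 k) := by
  rw [sSeq_of_two_le hk]
  have h1 := one_le_logb_two (x := k) (by exact_mod_cast hk)
  have h2 : Real.logb 2 (Real.logb 2 k) ≤ Real.logb 2 k := by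
    refine Real.logb_le_logb_of_le (by norm_num) (by linarith) ?_
    rw [Real.logb_le_iff_le_rpow (by norm_num) (by positivity), Real.rpow_natCast]
    exact_mod_cast Nat.lt_two_pow_self.le
  have : (0 : ℝ) ≤ k := by positivity
  nlinarith

lemma mul_logb_two (k : ℕ) :
    (k : ℝ) * Real.logb 2 k = 1 / Real.log 2 * ((k : ℝ) * Real.log k) := by
  rw [Real.logb]
  ring

lemma mul_log_nonneg (k : ℕ) : 0 ≤ (k : ℝ) * Real.log k :=
  mul_nonneg (by positivity) (Real.log_natCast_nonneg k)

lemma isTheta_sSeq :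
    Asymptotics.IsTheta Filter.atTop sSeq (fun k : ℕ => (k : ℝ) * Real.log (k : ℝ)) := by
  have hlog : 0 < Real.log 2 := Real.log_pos (by norm_num)
  constructor
  · refine Asymptotics.IsBigO.of_bound (24 * (1 / Real.log 2)) ?_
    filter_upwards [Filter.eventually_ge_atTop 2] with k hk
    rw [Real.norm_of_nonneg (sSeq_nonneg k), Real.norm_of_nonneg (mul_log_nonneg k), mul_assoc,
      ← mul_logb_two]
    exact sSeq_le hk
  · refine Asymptotics.IsBigO.of_bound (Real.log 2 / 4) ?_
    filter_upwards [Filter.eventually_ge_atTop 2] with k hk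
    rw [Real.norm_of_nonneg (sSeq_nonneg k), Real.norm_of_nonneg (mul_log_nonneg k)]
    have h1 := le_sSeq hk
    have h2 : (k : ℝ) * Real.log k = Real.log 2 * ((k : ℝ) * Real.logb 2 k) := by
      rw [mul_logb_two]
      field_simp
    rw [h2]
    nlinarith

/-- For `ℓ ≥ 1` the coefficients are at most `6ℓ` and `5ℓ / 2`, and `sSeq k ≤ 24 * k * log₂ k`; so
`66 = 6 + 60`, and `1 / log 2` changes the base. -/
lemma bound_le {k ℓ : ℕ} (hk : 2 ≤ k) (hℓ : 1 ≤ ℓ) :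
    (2 * (ℓ : ℝ) + 4) * ((k : ℝ) - 1) + (3 * (ℓ : ℝ) / 2 + 1) * sSeq k ≤
      66 * (1 / Real.log 2) * ((ℓ : ℝ) * ((k : ℝ) * Real.log k)) := by
  have e : 66 * (1 / Real.log 2) * ((ℓ : ℝ) * ((k : ℝ) * Real.log k)) =
      66 * (ℓ * ((k : ℝ) * Real.logb 2 k)) := by
    rw [mul_logb_two]
    ring
  rw [e]
  have hℓ' : (1 : ℝ) ≤ ℓ := by exact_mod_cast hℓ
  have hk' : (2 : ℝ) ≤ k := by exact_mod_cast hk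
  have h1 := one_le_logb_two (x := k) hk'
  have h2 : (k : ℝ) ≤ (k : ℝ) * Real.logb 2 k := le_mul_of_one_le_right (by linarith) h1
  have h3 : (2 * (ℓ : ℝ) + 4) * ((k : ℝ) - 1) ≤ (6 * ℓ) * ((k : ℝ) * Real.logb 2 k) :=
    mul_le_mul (by linarith) (by linarith) (by linarith) (by linarith)
  have h4 : (3 * (ℓ : ℝ) / 2 + 1) * sSeq k ≤ (5 / 2 * ℓ) * (24 * ((k : ℝ) * Real.logb 2 k)) :=
    mul_le_mul (by linarith) (sSeq_le hk) (sSeq_nonneg k) (by linarith)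
  linarith

end CyclePacking

theorem theorem1 :
    ∃ f : ℕ → ℕ → ℝ,
      (∀ k ℓ : ℕ, 0 ≤ f k ℓ) ∧
      (∀ k ℓ : ℕ, 1 ≤ k →
        f k ℓ = (2 * (ℓ : ℝ) + 4) * ((k : ℝ) - 1) + (3 * (ℓ : ℝ) / 2 + 1) * sSeq k) ∧
      Asymptotics.IsTheta Filter.atTop sSeq (fun k : ℕ => (k : ℝ) * Real.log (k : ℝ)) ∧
      (∃ C : ℝ, ∀ k ℓ : ℕ, 2 ≤ k → 1 ≤ ℓ →
        f k ℓ ≤ C * ((ℓ : ℝ) * ((k : ℝ) * Real.log (k : ℝ)))) ∧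
      ∀ (k ℓ : ℕ) (V : Type*) (G : SimpleGraph V),
        HasDisjointLongCycles G k ℓ ∨
          ∃ X : Finset V, (X.card : ℝ) ≤ f k ℓ ∧ MeetsLongCycles G ℓ X := by
  -- The formula is negative at `k = 0`, so `f` is set to `0` there; the empty packing settles that
  -- case.
  refine ⟨fun k ℓ => if 1 ≤ k then
    (2 * (ℓ : ℝ) + 4) * ((k : ℝ) - 1) + (3 * (ℓ : ℝ) / 2 + 1) * sSeq k else 0, ?_, ?_,
    CyclePacking.isTheta_sSeq, ⟨66 * (1 / Real.log 2), ?_⟩, ?_⟩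
  · intro k ℓ
    beta_reduce
    split_ifs with hk
    · have h1 : (0 : ℝ) ≤ (k : ℝ) - 1 := sub_nonneg.2 (by exact_mod_cast hk)
      have h2 := CyclePacking.sSeq_nonneg k
      positivity
    · exact le_rfl
  · intro k ℓ hk
    simp [hk]
  · intro k ℓ hk hℓ
    beta_reduce
    rw [if_pos (by omega)]
    exact CyclePacking.bound_le hk hℓ
  · intro k ℓ V G
    by_cases h : HasDisjointLongCycles G k ℓ
    · exact Or.inl h
    · refine Or.inr ?_
      have hk : 1 ≤ k := by
        by_contra hk
        obtain rfl : k = 0 := by omega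
        exact h ⟨Fin.elim0, fun i => i.elim0, fun i => i.elim0, fun i => i.elim0⟩
      simp only [hk, if_true]
      exact CyclePacking.exists_hitting_set G k ℓ h
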